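/- Let $a,b,c\ge 0$ be integers. A plane partition in an $a\times b\times c$ box is a set $T$ of unit cubes of the box $[0,a]\times[0,b]\times[0,c]$ (with integer vertices) that is closed downwards for the coordinatewise order; $|T|$ is its number of cubes. Its complement $\kappa(T)$ consists of the cubes of the box not in $T$, with all three coordinates reversed. Let $N_\kappa(a,b,c)$ be the number of plane partitions in the box with $\kappa(T)=T$. Put $$(n)_q=1+q+\dots+q^{n-1},\qquad (n)_q!=(1)_q(2)_q\cdots(n)_q,\qquad H(n)_q=(1)_q!\,(2)_q!\cdots(n-1)_q!,$$ $$N(a,b,c)_q=\frac{H(a+b+c)_q\,H(a)_q\,H(b)_q\,H(c)_q}{H(a+b)_q\,H(a+c)_q\,H(b+c)_q},$$ a rational function of $q$, and let $N(a,b,c)$ be the same expression with the ordinary hyperfactorial $H(n)=1!\,2!\cdots(n-1)!$ in place of $H(n)_q$. Corollary (Stanley). The rational function $N(a,b,c)_q$ has no pole at $q=-1$, and its value there satisfies $$N_\kappa(a,b,c)=N(a,b,c)_{-1}.$$ Moreover, this number is the number of plane partitions in the box with an even number of cubes minus the number of those with an odd number of cubes (Stembridge's $q=-1$ phenomenon),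 and the equation is equivalent to Stanley's product formula for $N_\kappa(a,b,c)$, since $N(a,b,c)_{-1}$ equals Stanley's product: it is $0$ if $a,b,c$ are all odd; if $c$ is even, it is $$N\left(\lceil a/2\rceil,\lfloor b/2\rfloor,c/2\right)\,N\left(\lfloor a/2\rfloor,\lceil b/2\rceil,c/2\right),$$ and if $a$ or $b$ is even, it is given by the same expression with the roles of the three axes permuted. -/

import Mathlib

open Polynomial

/-- A plane partition in an `a × b × c` box: a collection of unit cubes of the box (the cube
`[i,i+1] × [j,j+1] × [k,k+1]` is labelled `(i,j,k)`) which is stable under gravitational attraction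
towards the origin, i.e. closed downwards for the coordinatewise order. -/
def PlanePartition (a b c : ℕ) : Type :=
  {T : Finset (Fin a × Fin b × Fin c) // IsLowerSet (T : Set (Fin a × Fin b × Fin c))}

/-- Reversal of all three coordinates of the box. -/
def boxRev (a b c : ℕ) (x : Fin a × Fin b × Fin c) : Fin a × Fin b × Fin c :=
  (x.1.rev, x.2.1.rev, x.2.2.rev)

theorem boxRev_boxRev (a b c : ℕ) (x : Fin a × Fin b × Fin c) :
    boxRev a b c (boxRev a b c x) = x := by
  simp [boxRev]

theorem boxRev_le (a b c : ℕ) {x y : Fin a × Fin b × Fin c} (h : x ≤ y) :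
    boxRev a b c y ≤ boxRev a b c x := by
  simp only [boxRev, Prod.le_def, Fin.rev_le_rev] at h ⊢
  exact h

namespace PlanePartition

/-- The number of cubes `|T|` of a plane partition. -/
def size {a b c : ℕ} (T : PlanePartition a b c) : ℕ := T.1.card

/-- Complementation `κ`: take all cubes of the box which are not in the plane partition, and
reverse all three coordinates. -/
def compl {a b c : ℕ} (T : PlanePartition a b c) : PlanePartition a b c :=
  ⟨(T.1ᶜ).image (boxRev a b c), by
    intro x y hyx hx
    simp only [Finset.coe_image, Finset.coe_compl, Set.mem_image, Set.mem_compl_iff] at hx ⊢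
    obtain ⟨z, hz, rfl⟩ := hx
    refine ⟨boxRev a b c y, fun hy => hz (T.2 ?_ hy), boxRev_boxRev a b c y⟩
    have h := boxRev_le a b c hyx
    rwa [boxRev_boxRev] at h⟩

end PlanePartition

/-- `N_κ(a,b,c)`: the number of self-complementary plane partitions in an `a × b × c` box. -/
noncomputable def numSelfCompl (a b c : ℕ) : ℕ :=
  Nat.card {T : PlanePartition a b c // T.compl = T}

/-- The `q`-integer `(n)_q = 1 + q + ⋯ + q^(n-1)`, as a polynomial in `q = X`. -/
noncomputable def qInt (n : ℕ) : ℚ[X] := ∑ i ∈ Finset.range n, X ^ i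

/-- The `q`-factorial `(n)_q! = (1)_q (2)_q ⋯ (n)_q`. -/
noncomputable def qFact (n : ℕ) : ℚ[X] := ∏ i ∈ Finset.range n, qInt (i + 1)

/-- The `q`-hyperfactorial `H(n)_q = (1)_q! (2)_q! ⋯ (n-1)_q!` (the factor at `i = 0` is
`(0)_q! = 1`). -/
noncomputable def qHyper (n : ℕ) : ℚ[X] := ∏ i ∈ Finset.range n, qFact i

/-- MacMahon's `q`-product
`N(a,b,c)_q = H(a+b+c)_q H(a)_q H(b)_q H(c)_q / (H(a+b)_q H(a+c)_q H(b+c)_q)`,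
as a rational function of `q`. -/
noncomputable def qMacMahon (a b c : ℕ) : RatFunc ℚ :=
  algebraMap ℚ[X] (RatFunc ℚ) (qHyper (a + b + c) * qHyper a * qHyper b * qHyper c) /
    algebraMap ℚ[X] (RatFunc ℚ) (qHyper (a + b) * qHyper (a + c) * qHyper (b + c))

/-- The hyperfactorial `H(n) = 1! 2! ⋯ (n-1)!`. -/
def hyperFact (n : ℕ) : ℕ := ∏ i ∈ Finset.range n, Nat.factorial i

/-- MacMahon's product
`N(a,b,c) = H(a+b+c) H(a) H(b) H(c) / (H(a+b) H(a+c) H(b+c))`. -/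
def macMahon (a b c : ℕ) : ℚ :=
  (hyperFact (a + b + c) * hyperFact a * hyperFact b * hyperFact c : ℚ) /
    (hyperFact (a + b) * hyperFact (a + c) * hyperFact (b + c) : ℚ)

/-- Stanley's product formula for self-complementary plane partitions. In terms of parities,
it is `N(r,s,t)^2` for the box `2r × 2s × 2t`, `N(r,s,t) N(r+1,s,t)` for `(2r+1) × 2s × 2t`,
`N(r+1,s,t) N(r,s+1,t)` for `(2r+1) × (2s+1) × 2t` (and the same with the axes permuted), and
`0` if all three dimensions are odd. Below, `n / 2` and `(n + 1) / 2` are the natural numbers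
`⌊n/2⌋` and `⌈n/2⌉`. -/
def stanleyProduct (a b c : ℕ) : ℚ :=
  if Even c then
    macMahon ((a + 1) / 2) (b / 2) (c / 2) * macMahon (a / 2) ((b + 1) / 2) (c / 2)
  else if Even b then
    macMahon ((a + 1) / 2) (b / 2) (c / 2) * macMahon (a / 2) (b / 2) ((c + 1) / 2)
  else if Even a then
    macMahon (a / 2) ((b + 1) / 2) (c / 2) * macMahon (a / 2) (b / 2) ((c + 1) / 2)
  else 0

/-! The number `N_κ` is computed as a trace. Put `n = a + b` and let square matrices `g` act on the
polynomial ring of the generic `a × n` matrix `X` by `X ↦ X g`. The products of `c` maximal minors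
span an invariant subspace, a graded piece of the coordinate ring of a Grassmannian. Its basis of
standard monomials (`linearIndependent_bracketProd`, `bracketProd_mem_span`) is indexed by
multichains of increasing tuples, and these correspond to the plane partitions in the box.

The antidiagonal permutation matrix permutes the standard monomials up to one common sign, and the
permutation is complementation; its trace is therefore that sign times `N_κ`. The diagonal matrix
with entries `(-1)^j` multiplies the monomial of `T` by the same sign times `(-1)^|T|`. The two
matrices are conjugate (`trace_spanAction_rev`), so `N_κ = ∑ (-1)^|T|`, which is
`numSelfCompl_eq_sum`.

The right side is the generating function of plane partitions at `q = -1`. MacMahon's formula for it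
(`genFun_mul_qRect`) comes from the Vandermonde determinant in the powers `q^(l i + i)`: row
operations give a branching rule and hence a sum over Gelfand–Tsetlin patterns, which for a
rectangular top row are plane partitions, while the product formula for the determinant gives the
quotient of `q`-integers. So `N(a,b,c)_q` is a polynomial. At `q = -1` with one side even, the
factors `1 + q` cancel and the rest splits into two ordinary MacMahon products
(`genFun_eval_neg_one_of_even`). If all sides are odd, the box has odd volume and `N_κ = 0`. -/

/-! ### Leading terms of maximal minors and independence of standard monomials. -/

/-- The generic `a × n` matrix. -/
noncomputable def genericMatrix (a n : ℕ) :
    Matrix (Fin a) (Fin n) (MvPolynomial (Fin a ×ₗ Fin n) ℚ) :=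
  Matrix.of fun i j => MvPolynomial.X (toLex (i, j))

/-- The maximal minor of the generic `a × n` matrix with columns `I`. -/
noncomputable def bracket {a n : ℕ} (I : Fin a → Fin n) : MvPolynomial (Fin a ×ₗ Fin n) ℚ :=
  ((genericMatrix a n).submatrix id I).det

/-- The exponent of the diagonal term of a maximal minor. -/
noncomputable def diagExponent {a n : ℕ} (I : Fin a → Fin n) : (Fin a ×ₗ Fin n) →₀ ℕ :=
  ∑ i, Finsupp.single (toLex (i, I i)) 1

theorem diagExponent_apply {a n : ℕ} (I : Fin a → Fin n) (i : Fin a) (j : Fin n) :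
    diagExponent I (toLex (i, j)) = if I i = j then 1 else 0 := by
  classical
  simp only [diagExponent, Finsupp.finsetSum_apply, Finsupp.single_apply, toLex_inj, Prod.mk.injEq]
  rw [Finset.sum_eq_single i]
  · simp
  · intro k _ hk
    simp [hk]
  · simp

theorem bracket_eq_sum {a n : ℕ} (I : Fin a → Fin n) :
    bracket I = ∑ σ : Equiv.Perm (Fin a),
      MvPolynomial.monomial (diagExponent (I ∘ σ)) ((Equiv.Perm.sign σ : ℤ) : ℚ) := by
  rw [bracket, ← Matrix.det_transpose, Matrix.det_apply]
  refine Finset.sum_congr rfl fun σ _ => ?_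
  have h : (∏ i, (MvPolynomial.X (toLex (i, I (σ i))) : MvPolynomial (Fin a ×ₗ Fin n) ℚ)) =
      MvPolynomial.monomial (diagExponent (I ∘ σ)) 1 := by
    rw [diagExponent, MvPolynomial.monomial_sum_one]
    rfl
  simp only [genericMatrix, Matrix.transpose_apply, Matrix.submatrix_apply, Matrix.of_apply, id]
  rw [h, Units.smul_def, ← Int.cast_smul_eq_zsmul ℚ, MvPolynomial.smul_monomial]
  simp

/-- In the first row `i` moved by `σ`, necessarily `σ i > i`. So the two exponents first differ at
the variable `(i, I i)`, which occurs only in the diagonal term. -/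
theorem diagExponent_lt {a n : ℕ} {I : Fin a → Fin n} (hI : StrictMono I)
    {σ : Equiv.Perm (Fin a)} (hσ : σ ≠ 1) :
    MonomialOrder.lex.toSyn (diagExponent (I ∘ σ)) < MonomialOrder.lex.toSyn (diagExponent I) := by
  classical
  obtain ⟨i, hi, hmin⟩ : ∃ i, σ i ≠ i ∧ ∀ j < i, σ j = j := by
    have hne : (Finset.univ.filter fun i => σ i ≠ i).Nonempty := by
      by_contra h
      apply hσ
      ext1 i
      by_contra hi
      exact h ⟨i, by simpa using hi⟩
    refine ⟨_, by simpa using Finset.min'_mem _ hne, fun j hj => ?_⟩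
    by_contra h
    exact absurd (Finset.min'_le _ j (by simpa using h)) (not_le.mpr hj)
  have hlt : i < σ i := by
    refine lt_of_le_of_ne (not_lt.mp fun h => ?_) (Ne.symm hi)
    have := hmin _ h
    exact hi (σ.injective this)
  rw [MonomialOrder.lex_lt_iff, Finsupp.Lex.lt_iff]
  refine ⟨toLex (i, I i), fun j hj => ?_, ?_⟩
  · obtain ⟨j, k⟩ := j
    change diagExponent (I ∘ σ) (toLex (j, k)) = diagExponent I (toLex (j, k))
    rw [diagExponent_apply, diagExponent_apply]
    have hj' : toLex (j, k) < toLex (i, I i) := hj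
    rw [Prod.Lex.toLex_lt_toLex] at hj'
    rcases hj' with h | ⟨h, h'⟩
    · simp [hmin j h]
    · dsimp only at h h'
      subst h
      rw [if_neg, if_neg]
      · exact fun h => absurd h' (by simp [h])
      · intro h
        have := hI hlt
        simp only [Function.comp_apply] at h
        rw [h] at this
        exact lt_asymm this h'
  · change diagExponent (I ∘ σ) (toLex (i, I i)) < diagExponent I (toLex (i, I i))
    rw [diagExponent_apply, diagExponent_apply, if_neg, if_pos rfl]
    · exact Nat.one_pos
    · exact fun h => hi (hI.injective h)

theorem degree_bracket {a n : ℕ} {I : Fin a → Fin n} (hI : StrictMono I) :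
    MonomialOrder.lex.Monic (bracket I) ∧ MonomialOrder.lex.degree (bracket I) = diagExponent I := by
  classical
  have hcoeff : (bracket I).coeff (diagExponent I) = 1 := by
    rw [bracket_eq_sum, MvPolynomial.coeff_sum, Finset.sum_eq_single 1]
    · simp
    · intro σ _ hσ
      rw [MvPolynomial.coeff_monomial, if_neg]
      exact fun h => (diagExponent_lt hI hσ).ne (by rw [h])
    · simp
  have hdeg : MonomialOrder.lex.degree (bracket I) = diagExponent I := by
    apply MonomialOrder.lex.toSyn.injective
    apply le_antisymm
    · rw [MonomialOrder.degree_le_iff]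
      intro d hd
      rw [bracket_eq_sum] at hd
      obtain ⟨σ, -, hσ⟩ := Finset.mem_biUnion.mp (MvPolynomial.support_sum hd)
      have := Finset.mem_singleton.mp (MvPolynomial.support_monomial_subset hσ)
      subst this
      by_cases h : σ = 1
      · subst h
        simp
      · exact (diagExponent_lt hI h).le
    · apply MonomialOrder.le_degree
      rw [MvPolynomial.mem_support_iff, hcoeff]
      exact one_ne_zero
  refine ⟨?_, hdeg⟩
  rw [MonomialOrder.Monic, MonomialOrder.leadingCoeff, hdeg, hcoeff]

/-- Multichains of length `c` of strictly increasing `a`-tuples in `Fin n`: the index set of the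
standard monomials. -/
abbrev StdFamily (a n c : ℕ) : Type :=
  {I : Fin c → Fin a → Fin n // (∀ k, StrictMono (I k)) ∧ Monotone I}

/-- The product of the maximal minors in a family. -/
noncomputable def bracketProd {a n c : ℕ} (I : Fin c → Fin a → Fin n) :
    MvPolynomial (Fin a ×ₗ Fin n) ℚ :=
  ∏ k, bracket (I k)

theorem degree_bracketProd {a n c : ℕ} {I : Fin c → Fin a → Fin n} (hI : ∀ k, StrictMono (I k)) :
    MonomialOrder.lex.Monic (bracketProd I) ∧
      MonomialOrder.lex.degree (bracketProd I) = ∑ k, diagExponent (I k) := by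
  refine ⟨MonomialOrder.Monic.prod fun k _ => (degree_bracket (hI k)).1, ?_⟩
  rw [bracketProd, MonomialOrder.degree_prod]
  · exact Finset.sum_congr rfl fun k _ => (degree_bracket (hI k)).2
  · exact fun k _ => (degree_bracket (hI k)).1.ne_zero

/-- A sorted list is determined by its multiset of entries. -/
theorem Monotone.eq_of_card_fiber_eq {c : ℕ} {α : Type*} [LinearOrder α] {f g : Fin c → α}
    (hf : Monotone f) (hg : Monotone g)
    (h : ∀ j, (Finset.univ.filter fun k => f k = j).card =
      (Finset.univ.filter fun k => g k = j).card) : f = g := by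
  apply List.ofFn_injective
  apply List.Perm.eq_of_pairwise (le := (· ≤ ·)) (fun x y _ _ h1 h2 => le_antisymm h1 h2)
  · exact hf.sortedLE_ofFn.pairwise
  · exact hg.sortedLE_ofFn.pairwise
  · rw [List.perm_iff_count]
    intro j
    have key : ∀ u : Fin c → α, (List.ofFn u).count j =
        (Finset.univ.filter fun k => u k = j).card := by
      intro u
      rw [List.ofFn_eq_map, List.count_eq_countP, List.countP_map, List.countP_eq_length_filter,
        ← List.toFinset_card_of_nodup ((List.nodup_finRange c).filter _), List.toFinset_filter]
      congr 1
      ext k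
      simp
    rw [key, key, h]

/-- The exponent of the variable `(i, j)` counts the `k` with `I k i = j`. Since the family is a
multichain, `k ↦ I k i` is monotone and is recovered from these counts. -/
theorem StdFamily.sum_diagExponent_injective {a n c : ℕ} :
    Function.Injective fun I : StdFamily a n c => ∑ k, diagExponent (I.1 k) := by
  intro I J h
  apply Subtype.ext
  suffices ∀ i, (fun k => I.1 k i) = fun k => J.1 k i by
    funext k i
    exact congrFun (this i) k
  intro i
  refine Monotone.eq_of_card_fiber_eq (fun k l hkl => I.2.2 hkl i) (fun k l hkl => J.2.2 hkl i) ?_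
  intro j
  have := DFunLike.congr_fun h (toLex (i, j))
  simpa only [Finsupp.finsetSum_apply, diagExponent_apply, ← Finset.card_filter] using this

/-- A family of monic polynomials with pairwise distinct degrees is linearly independent. -/
theorem MonomialOrder.linearIndependent_of_degree_injective {σ ι R : Type*} [CommRing R]
    (m : MonomialOrder σ) {p : ι → MvPolynomial σ R} (hp : ∀ i, m.Monic (p i))
    (hinj : Function.Injective fun i => m.degree (p i)) : LinearIndependent R p := by
  classical
  rw [linearIndependent_iff']
  intro s g hg
  by_contra! hne
  obtain ⟨i₀, hi₀, hgi₀⟩ := hne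
  obtain ⟨i, hi, hmax⟩ := Finset.exists_max_image (s.filter fun i => g i ≠ 0)
    (fun i => m.toSyn (m.degree (p i))) ⟨i₀, by simp [hi₀, hgi₀]⟩
  simp only [Finset.mem_filter] at hi hmax
  have h := congrArg (MvPolynomial.coeff (m.degree (p i))) hg
  rw [MvPolynomial.coeff_sum, Finset.sum_eq_single i] at h
  · rw [MvPolynomial.coeff_smul, (hp i).coeff_degree] at h
    exact hi.2 (by simpa using h)
  · intro j hj hji
    by_cases hgj : g j = 0
    · simp [hgj]
    rw [MvPolynomial.coeff_smul, m.coeff_eq_zero_of_lt, smul_zero]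
    refine lt_of_le_of_ne (hmax j ⟨hj, hgj⟩) fun he => hji (hinj (m.toSyn.injective he))
  · exact fun h => absurd hi.1 h

theorem linearIndependent_bracketProd (a n c : ℕ) :
    LinearIndependent ℚ fun I : StdFamily a n c => bracketProd I.1 := by
  apply MonomialOrder.lex.linearIndependent_of_degree_injective
  · exact fun I => (degree_bracketProd I.2.1).1
  · intro I J h
    apply StdFamily.sum_diagExponent_injective
    simpa only [(degree_bracketProd I.2.1).2, (degree_bracketProd J.2.1).2] using h

/-! ### Straightening: standard monomials span all products of maximal minors. -/

/-- The restriction of the determinant to the rows satisfying `P`, the other rows being fixed. -/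
noncomputable def detRestrict {a : ℕ} {R : Type*} [CommRing R] (P : Fin a → Prop) [DecidablePred P]
    (z : Fin a → Fin a → R) : (Fin a → R) [⋀^{i // P i}]→ₗ[R] R :=
  { (Matrix.detRowAlternating (R := R) (n := Fin a)).toMultilinearMap.domDomRestrict P
      (fun j => z j.1) with
    map_eq_zero_of_eq' := by
      intro v i j hv hij
      change Matrix.detRowAlternating _ = 0
      apply AlternatingMap.map_eq_zero_of_eq _ _ (i := i.1) (j := j.1)
      · simp [i.2, j.2, hv]
      · exact fun h => hij (Subtype.ext h) }

theorem detRestrict_apply {a : ℕ} {R : Type*} [CommRing R] (P : Fin a → Prop) [DecidablePred P]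
    (z : Fin a → Fin a → R) (v : {i // P i} → Fin a → R) :
    detRestrict P z v = Matrix.det (Matrix.of fun i => if h : P i then v ⟨i, h⟩ else z i) :=
  rfl

theorem bracket_eq_det {a n : ℕ} (I : Fin a → Fin n) :
    bracket I = Matrix.det (Matrix.of fun i j => genericMatrix a n j (I i)) := by
  rw [bracket, ← Matrix.det_transpose]
  rfl

/-- A permutation that does not preserve the two blocks replaces some left values, all at least `m`,
by equally many right values, all below `m`. This makes every nontrivial exchange lower the sum of
the first tuple. -/
theorem sum_comp_inl_lt {α β : Type*} [Fintype α] [Fintype β] {f : α ⊕ β → ℕ} {m : ℕ}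
    (hl : ∀ x, m ≤ f (.inl x)) (hr : ∀ y, f (.inr y) < m) {σ : Equiv.Perm (α ⊕ β)}
    (hσ : σ ∉ (Equiv.Perm.sumCongrHom α β).range) :
    ∑ x, f (σ (.inl x)) < ∑ x, f (.inl x) := by
  classical
  set L : Finset (α ⊕ β) := Finset.univ.map Function.Embedding.inl with hL
  set S : Finset (α ⊕ β) := L.map σ.toEmbedding with hS
  have hmemL : ∀ z, z ∈ L ↔ ∃ x, Sum.inl x = z := by simp [hL]
  have h1 : ∑ x, f (σ (.inl x)) = ∑ z ∈ S, f z := by simp [hS, hL]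
  have h2 : ∑ x, f (.inl x) = ∑ z ∈ L, f z := by simp [hL]
  rw [h1, h2, ← Finset.sum_inter_add_sum_sdiff S L, ← Finset.sum_inter_add_sum_sdiff L S,
    Finset.inter_comm L S]
  have hcard : (S \ L).card = (L \ S).card := by
    have h3 := Finset.card_sdiff_add_card_inter S L
    have h4 := Finset.card_sdiff_add_card_inter L S
    rw [Finset.inter_comm] at h4
    have : S.card = L.card := by simp [hS]
    omega
  have hne : (S \ L).Nonempty := by
    by_contra h
    rw [Finset.not_nonempty_iff_eq_empty, Finset.sdiff_eq_empty_iff_subset] at h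
    apply hσ
    apply Equiv.Perm.mem_sumCongrHom_range_of_perm_mapsTo_inl
    rintro _ ⟨x, rfl⟩
    exact (hmemL _).mp (h (by simp [hS, hL]))
  have h5 : ∑ z ∈ S \ L, f z < (S \ L).card • m := by
    refine lt_of_lt_of_le (Finset.sum_lt_sum_of_nonempty (g := fun _ => m) hne ?_) (by simp)
    rintro (x | y) hz
    · exact absurd ((hmemL _).mpr ⟨x, rfl⟩) (Finset.mem_sdiff.mp hz).2
    · exact hr y
  have h6 : (L \ S).card • m ≤ ∑ z ∈ L \ S, f z := by
    refine Finset.card_nsmul_le_sum _ _ _ fun z hz => ?_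
    obtain ⟨x, rfl⟩ := (hmemL z).mp (Finset.mem_sdiff.mp hz).1
    exact hl x
  rw [hcard] at h5
  omega

/-- The sum of the entries of a tuple. -/
def tupleSum {a n : ℕ} (I : Fin a → Fin n) : ℕ := ∑ i, (I i : ℕ)

theorem tupleSum_comp_perm {a n : ℕ} (I : Fin a → Fin n) (σ : Equiv.Perm (Fin a)) :
    tupleSum (I ∘ σ) = tupleSum I :=
  Equiv.sum_comp σ fun i => (I i : ℕ)

theorem tupleSum_eq_add {a n : ℕ} (P : Fin a → Prop) [DecidablePred P] (I : Fin a → Fin n) :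
    tupleSum I = ∑ i : {i // P i}, (I i : ℕ) + ∑ i : {i // ¬ P i}, (I i : ℕ) :=
  (Fintype.sum_subtype_add_sum_subtype P fun i => (I i : ℕ)).symm

/-- The exchange relation for a violation `J s < I s`. -/
theorem bracket_mul_bracket_mem_span {a n : ℕ} {I J : Fin a → Fin n} (hI : StrictMono I)
    (hJ : StrictMono J) {s : Fin a} (hs : J s < I s) :
    bracket I * bracket J ∈ Submodule.span ℚ {p | ∃ I' J' : Fin a → Fin n,
      tupleSum I' < tupleSum I ∧ tupleSum I' + tupleSum J' = tupleSum I + tupleSum J ∧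
      p = bracket I' * bracket J'} := by
  classical
  let col : Fin n → Fin a → MvPolynomial (Fin a ×ₗ Fin n) ℚ := fun k j => genericMatrix a n j k
  let A := detRestrict (fun i => s ≤ i) (fun i => col (I i))
  let B := detRestrict (fun i => i ≤ s) (fun i => col (J i))
  let v : {i // s ≤ i} ⊕ {i // i ≤ s} → Fin n := Sum.elim (fun i => I i) (fun i => J i)
  let Iσ : Equiv.Perm ({i // s ≤ i} ⊕ {i // i ≤ s}) → Fin a → Fin n := fun σ i =>
    if h : s ≤ i then v (σ (.inl ⟨i, h⟩)) else I i
  let Jσ : Equiv.Perm ({i // s ≤ i} ⊕ {i // i ≤ s}) → Fin a → Fin n := fun σ i =>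
    if h : i ≤ s then v (σ (.inr ⟨i, h⟩)) else J i
  have hA : ∀ σ, A (fun i => col (v (σ (.inl i)))) = bracket (Iσ σ) := by
    intro σ
    rw [bracket_eq_det, detRestrict_apply]
    congr 1
    ext i j
    simp only [Matrix.of_apply, Iσ]
    split_ifs <;> rfl
  have hB : ∀ σ, B (fun i => col (v (σ (.inr i)))) = bracket (Jσ σ) := by
    intro σ
    rw [bracket_eq_det, detRestrict_apply]
    congr 1
    ext i j
    simp only [Matrix.of_apply, Jσ]
    split_ifs <;> rfl
  -- The rows `i ≥ s` of the first minor and `i ≤ s` of the second supply `a + 1` vectors of length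
  -- `a`; they are dependent, so any alternating map vanishes on them.
  have hzero : A.domCoprod B (fun x => col (v x)) = 0 := by
    apply AlternatingMap.map_linearDependent
    intro h
    have := h.fintype_card_le_finrank
    rw [Module.finrank_fintype_fun_eq_card, Fintype.card_sum, Fintype.card_fin] at this
    have h1 : Fintype.card {i // s ≤ i} + Fintype.card {i // ¬ s ≤ i} = a := by
      rw [Fintype.card_subtype_compl, Fintype.card_fin]
      have := Fintype.card_subtype_le (fun i => s ≤ i)
      rw [Fintype.card_fin] at this
      omega
    have h2 : Fintype.card {i // ¬ s ≤ i} < Fintype.card {i // i ≤ s} := by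
      rw [Fintype.card_subtype, Fintype.card_subtype]
      apply Finset.card_lt_card
      refine ⟨fun i => by simpa using le_of_lt, fun h => ?_⟩
      have := h (show s ∈ _ by simp)
      simp at this
    omega
  -- `domCoprod` sums over cosets of the block-preserving permutations. Multiplying the tensor
  -- factors turns each coset into a signed product of two minors, and the trivial coset into the
  -- original product.
  let F : Equiv.Perm.ModSumCongr {i // s ≤ i} {i // i ≤ s} → MvPolynomial (Fin a ×ₗ Fin n) ℚ :=
    fun q => LinearMap.mul' _ _ (AlternatingMap.domCoprod.summand A B q (fun x => col (v x)))
  have hterm : ∀ σ, F (Quotient.mk'' σ) =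
      Equiv.Perm.sign σ • (bracket (Iσ σ) * bracket (Jσ σ)) := by
    intro σ
    dsimp only [F]
    rw [AlternatingMap.domCoprod.summand_mk'', ← hA, ← hB, Units.smul_def, Units.smul_def,
      ← LinearMap.mul'_apply (R := MvPolynomial (Fin a ×ₗ Fin n) ℚ), ← map_zsmul]
    rfl
  have hsum : ∑ q, F q = 0 := by
    have h := congrArg (LinearMap.mul' _ _) hzero
    rw [AlternatingMap.domCoprod_apply, sum_apply, map_sum, map_zero] at h
    exact h
  have hI1 : Iσ 1 = I := by
    funext i
    simp [Iσ, v]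
  have hJ1 : Jσ 1 = J := by
    funext i
    simp [Jσ, v]
  let q₁ : Equiv.Perm.ModSumCongr {i // s ≤ i} {i // i ≤ s} := Quotient.mk'' 1
  have hq₁ : F q₁ = bracket I * bracket J := by
    rw [show F q₁ = _ from hterm 1, hI1, hJ1, Equiv.Perm.sign_one, one_smul]
  rw [← Finset.add_sum_erase _ _ (Finset.mem_univ q₁), hq₁] at hsum
  rw [eq_neg_of_add_eq_zero_left hsum]
  apply Submodule.neg_mem
  apply Submodule.sum_mem
  intro q hq
  induction q using Quotient.inductionOn' with | _ σ
  have hσ : σ ∉ (Equiv.Perm.sumCongrHom {i // s ≤ i} {i // i ≤ s}).range := by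
    intro h
    refine (Finset.mem_erase.mp hq).1 (Quotient.sound' ?_)
    rw [QuotientGroup.leftRel_apply]
    simpa using h
  rw [hterm σ, Units.smul_def, ← Int.cast_smul_eq_zsmul ℚ]
  apply Submodule.smul_mem
  apply Submodule.subset_span
  -- The threshold is `I s`: the exchanged entries of `I` are at least `I s`, those of `J` at most
  -- `J s < I s`.
  have hlt : ∑ x, (v (σ (.inl x)) : ℕ) < ∑ x, (v (.inl x) : ℕ) := by
    apply sum_comp_inl_lt (f := fun x => (v x : ℕ)) (m := (I s : ℕ)) _ _ hσ
    · exact fun x => hI.monotone x.2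
    · exact fun y => lt_of_le_of_lt (hJ.monotone y.2) hs
  have htot : ∑ x, (v (σ (.inl x)) : ℕ) + ∑ x, (v (σ (.inr x)) : ℕ) =
      ∑ x, (v (.inl x) : ℕ) + ∑ x, (v (.inr x) : ℕ) := by
    rw [← Fintype.sum_sum_type (fun x => (v (σ x) : ℕ)), ← Fintype.sum_sum_type (fun x => (v x : ℕ))]
    exact Equiv.sum_comp σ fun x => (v x : ℕ)
  have e1 : tupleSum (Iσ σ) = ∑ x, (v (σ (.inl x)) : ℕ) + ∑ i : {i // ¬ s ≤ i}, (I i : ℕ) := by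
    rw [tupleSum_eq_add (fun i => s ≤ i)]
    congr 1
    · exact Finset.sum_congr rfl fun i _ => by simp [Iσ, i.2]
    · exact Finset.sum_congr rfl fun i _ => by simp only [Iσ, dif_neg i.2]
  have e2 : tupleSum I = ∑ x, (v (.inl x) : ℕ) + ∑ i : {i // ¬ s ≤ i}, (I i : ℕ) :=
    tupleSum_eq_add (fun i => s ≤ i) I
  have e3 : tupleSum (Jσ σ) = ∑ x, (v (σ (.inr x)) : ℕ) + ∑ i : {i // ¬ i ≤ s}, (J i : ℕ) := by
    rw [tupleSum_eq_add (fun i => i ≤ s)]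
    congr 1
    · exact Finset.sum_congr rfl fun i _ => by simp [Jσ, i.2]
    · exact Finset.sum_congr rfl fun i _ => by simp only [Jσ, dif_neg i.2]
  have e4 : tupleSum J = ∑ x, (v (.inr x) : ℕ) + ∑ i : {i // ¬ i ≤ s}, (J i : ℕ) :=
    tupleSum_eq_add (fun i => i ≤ s) J
  exact ⟨_, _, by omega, by omega, rfl⟩

theorem bracket_comp_perm {a n : ℕ} (I : Fin a → Fin n) (σ : Equiv.Perm (Fin a)) :
    bracket (I ∘ σ) = ((Equiv.Perm.sign σ : ℤ) : ℚ) • bracket I := by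
  have := Matrix.det_permute' σ ((genericMatrix a n).submatrix id I)
  rw [bracket, bracket, Int.cast_smul_eq_zsmul, zsmul_eq_mul, ← this]
  rfl

theorem bracket_eq_zero {a n : ℕ} {I : Fin a → Fin n} (hI : ¬ Function.Injective I) :
    bracket I = 0 := by
  obtain ⟨i, j, h, hij⟩ : ∃ i j, I i = I j ∧ i ≠ j := by
    simpa [Function.Injective] using hI
  exact Matrix.det_zero_of_column_eq hij fun k => by simp [h]

/-- The potential function increased by every straightening step. -/
def sqSum {a n c : ℕ} (I : Fin c → Fin a → Fin n) : ℕ := ∑ k, tupleSum (I k) ^ 2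

theorem sqSum_le {a n c : ℕ} (I : Fin c → Fin a → Fin n) : sqSum I ≤ c * (a * n) ^ 2 := by
  have h : ∀ k ∈ Finset.univ, tupleSum (I k) ^ 2 ≤ (a * n) ^ 2 := by
    intro k _
    apply Nat.pow_le_pow_left
    have : ∀ i ∈ Finset.univ, (I k i : ℕ) ≤ n := fun i _ => (I k i).2.le
    simpa [tupleSum] using Finset.sum_le_card_nsmul _ _ _ this
  simpa [sqSum] using Finset.sum_le_card_nsmul _ _ _ h

theorem bracketProd_mem_span {a n c : ℕ} (I : Fin c → Fin a → Fin n) :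
    bracketProd I ∈ Submodule.span ℚ (Set.range fun I : StdFamily a n c => bracketProd I.1) := by
  classical
  induction hN : c * (a * n) ^ 2 - sqSum I using Nat.strong_induction_on generalizing I with
  | _ N ih
  subst hN
  by_cases hinj : ∀ k, Function.Injective (I k)
  swap
  · push Not at hinj
    obtain ⟨k, hk⟩ := hinj
    rw [bracketProd, Finset.prod_eq_zero (Finset.mem_univ k) (bracket_eq_zero hk)]
    exact Submodule.zero_mem _
  wlog hI : ∀ k, StrictMono (I k) generalizing I
  · have h := this (fun k => I k ∘ Tuple.sort (I k)) ?_
      (fun k => (hinj k).comp (Tuple.sort (I k)).injective)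
      (fun k => (Tuple.monotone_sort (I k)).strictMono_of_injective
        ((hinj k).comp (Tuple.sort (I k)).injective))
    · have e : bracketProd (fun k => I k ∘ Tuple.sort (I k)) =
          (∏ k, ((Equiv.Perm.sign (Tuple.sort (I k)) : ℤ) : ℚ)) • bracketProd I := by
        simp only [bracketProd, bracket_comp_perm, Finset.prod_smul]
      rw [e] at h
      exact (Submodule.smul_mem_iff _ (Finset.prod_ne_zero_iff.mpr fun k _ => by simp)).mp h
    · have e : sqSum (fun k => I k ∘ Tuple.sort (I k)) = sqSum I :=
        Finset.sum_congr rfl fun k _ => by rw [tupleSum_comp_perm]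
      rw [e]
      exact ih
  by_cases htot : ∀ k l, I k ≤ I l ∨ I l ≤ I k
  · let σ := Tuple.sort fun k => tupleSum (I k)
    have hmono : Monotone (I ∘ σ) := by
      intro k l hkl
      have hs : tupleSum (I (σ k)) ≤ tupleSum (I (σ l)) :=
        Tuple.monotone_sort (fun k => tupleSum (I k)) hkl
      rcases htot (σ k) (σ l) with h | h
      · exact h
      · intro i
        -- Comparable in the wrong direction, yet with sums in the sorted order: the sums, hence the
        -- tuples, are equal.
        have he := (Finset.sum_eq_sum_iff_of_le (s := Finset.univ)
          (f := fun i => (I (σ l) i : ℕ)) (g := fun i => (I (σ k) i : ℕ)) fun i _ => h i).mp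
          (le_antisymm (Finset.sum_le_sum fun i _ => h i) hs) i (Finset.mem_univ i)
        exact he.ge
    have he : bracketProd (I ∘ σ) = bracketProd I := Equiv.prod_comp σ fun k => bracket (I k)
    rw [← he]
    exact Submodule.subset_span ⟨⟨I ∘ σ, fun k => hI _, hmono⟩, rfl⟩
  · push Not at htot
    obtain ⟨k, l, hkl, hlk⟩ := htot
    -- The exchange lowers the sum of `I k` and preserves the total. Doing this to the tuple of
    -- smaller sum spreads the two sums apart, so the sum of their squares grows.
    wlog hs : tupleSum (I k) ≤ tupleSum (I l) generalizing k l
    · exact this l k hlk hkl (le_of_not_ge hs)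
    obtain ⟨s, hs'⟩ : ∃ s, I l s < I k s := by
      simpa [Pi.le_def] using hkl
    have hne : l ≠ k := by
      rintro rfl
      exact hkl le_rfl
    set rest := ∏ m ∈ (Finset.univ.erase k).erase l, bracket (I m) with hrest
    have hprod : ∀ J : Fin c → Fin a → Fin n, bracketProd J =
        bracket (J k) * bracket (J l) * ∏ m ∈ (Finset.univ.erase k).erase l, bracket (J m) := by
      intro J
      rw [bracketProd, ← Finset.mul_prod_erase _ _ (Finset.mem_univ k),
        ← Finset.mul_prod_erase _ _ (Finset.mem_erase.mpr ⟨hne, Finset.mem_univ l⟩), mul_assoc]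
    have hsq : ∀ J : Fin c → Fin a → Fin n, sqSum J =
        tupleSum (J k) ^ 2 + (tupleSum (J l) ^ 2 +
          ∑ m ∈ (Finset.univ.erase k).erase l, tupleSum (J m) ^ 2) := by
      intro J
      rw [sqSum, ← Finset.add_sum_erase _ _ (Finset.mem_univ k),
        ← Finset.add_sum_erase _ _ (Finset.mem_erase.mpr ⟨hne, Finset.mem_univ l⟩)]
    rw [hprod]
    have hmem := bracket_mul_bracket_mem_span (hI k) (hI l) hs'
    refine Submodule.span_induction (p := fun p _ => p * rest ∈ _) ?_ ?_ ?_ ?_ hmem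
    · rintro _ ⟨I', J', h1, h2, rfl⟩
      let J := Function.update (Function.update I k I') l J'
      have hJk : J k = I' := by simp [J, hne.symm]
      have hJl : J l = J' := by simp [J]
      have hJm : ∀ m ∈ (Finset.univ.erase k).erase l, J m = I m := by
        intro m hm
        simp only [Finset.mem_erase] at hm
        simp [J, hm.1, hm.2.1]
      have hJ : bracketProd J = bracket I' * bracket J' * rest := by
        rw [hprod, hJk, hJl, hrest]
        congr 1
        exact Finset.prod_congr rfl fun m hm => by rw [hJm m hm]
      have hJs : sqSum I < sqSum J := by
        have hrest : ∑ m ∈ (Finset.univ.erase k).erase l, tupleSum (J m) ^ 2 =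
            ∑ m ∈ (Finset.univ.erase k).erase l, tupleSum (I m) ^ 2 :=
          Finset.sum_congr rfl fun m hm => by rw [hJm m hm]
        rw [hsq, hsq, hJk, hJl, hrest]
        nlinarith
      rw [← hJ]
      refine ih _ ?_ J rfl
      have := sqSum_le J
      omega
    · simp
    · intro x y _ _ hx hy
      rw [add_mul]
      exact Submodule.add_mem _ hx hy
    · intro r x _ hx
      rw [smul_mul_assoc]
      exact Submodule.smul_mem _ _ hx

/-! ### The matrix action and its traces in the standard basis. -/

/-- The linear substitution `X ↦ X g` of the generic matrix. -/
noncomputable def columnAction {a n : ℕ} (g : Matrix (Fin n) (Fin n) ℚ) :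
    MvPolynomial (Fin a ×ₗ Fin n) ℚ →ₐ[ℚ] MvPolynomial (Fin a ×ₗ Fin n) ℚ :=
  MvPolynomial.aeval fun x => ∑ k, g k (ofLex x).2 • genericMatrix a n (ofLex x).1 k

theorem columnAction_genericMatrix {a n : ℕ} (g : Matrix (Fin n) (Fin n) ℚ) (i : Fin a)
    (j : Fin n) :
    columnAction g (genericMatrix a n i j) = ∑ k, g k j • genericMatrix a n i k := by
  simp only [columnAction, genericMatrix, Matrix.of_apply, MvPolynomial.aeval_X, ofLex_toLex]

theorem columnAction_mul {a n : ℕ} (g h : Matrix (Fin n) (Fin n) ℚ) :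
    (columnAction g : MvPolynomial (Fin a ×ₗ Fin n) ℚ →ₐ[ℚ] _).comp (columnAction h) =
      columnAction (g * h) := by
  apply MvPolynomial.algHom_ext
  rintro ⟨i, j⟩
  change columnAction g (columnAction h (genericMatrix a n i j)) =
    columnAction (g * h) (genericMatrix a n i j)
  simp only [columnAction_genericMatrix, map_sum, map_smul, Matrix.mul_apply, Finset.smul_sum,
    Finset.sum_smul, smul_smul]
  rw [Finset.sum_comm]
  simp only [mul_comm]

/-- Multilinear expansion of the determinant. The sum over all tuples, not only increasing ones,
suffices because the spanning lemma accepts arbitrary families. -/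
theorem columnAction_bracket {a n : ℕ} (g : Matrix (Fin n) (Fin n) ℚ) (I : Fin a → Fin n) :
    columnAction g (bracket I) = ∑ J : Fin a → Fin n, (∏ i, g (J i) (I i)) • bracket J := by
  classical
  have h1 : columnAction g (bracket I) = Matrix.detRowAlternating
      (fun i => ∑ k, algebraMap ℚ (MvPolynomial (Fin a ×ₗ Fin n) ℚ) (g k (I i)) •
        fun j => genericMatrix a n j k) := by
    rw [bracket_eq_det, AlgHom.map_det]
    change Matrix.det _ = Matrix.det _
    congr 1
    ext1 i j
    simp only [AlgHom.mapMatrix_apply, Matrix.map_apply, Matrix.of_apply,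
      columnAction_genericMatrix, Finset.sum_apply, Pi.smul_apply, algebraMap_smul]
  rw [h1, ← AlternatingMap.coe_multilinearMap, MultilinearMap.map_sum]
  refine Finset.sum_congr rfl fun J _ => ?_
  rw [MultilinearMap.map_smul_univ, ← map_prod, algebraMap_smul, bracket_eq_det]
  rfl

theorem columnAction_bracketProd_mem {a n c : ℕ} (g : Matrix (Fin n) (Fin n) ℚ)
    (I : Fin c → Fin a → Fin n) :
    columnAction g (bracketProd I) ∈
      Submodule.span ℚ (Set.range fun I : StdFamily a n c => bracketProd I.1) := by
  classical
  rw [bracketProd, map_prod]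
  simp only [columnAction_bracket]
  rw [Finset.prod_univ_sum]
  refine Submodule.sum_mem _ fun J _ => ?_
  rw [Finset.prod_smul]
  exact Submodule.smul_mem _ _ (bracketProd_mem_span J)

/-- The span of the products of `c` maximal minors of the generic `a × n` matrix. -/
noncomputable abbrev bracketSpan (a n c : ℕ) : Submodule ℚ (MvPolynomial (Fin a ×ₗ Fin n) ℚ) :=
  Submodule.span ℚ (Set.range fun I : StdFamily a n c => bracketProd I.1)

/-- The basis of standard monomials. -/
noncomputable def stdBasis (a n c : ℕ) : Module.Basis (StdFamily a n c) ℚ (bracketSpan a n c) :=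
  Module.Basis.span (linearIndependent_bracketProd a n c)

theorem stdBasis_apply {a n c : ℕ} (I : StdFamily a n c) :
    (stdBasis a n c I : MvPolynomial (Fin a ×ₗ Fin n) ℚ) = bracketProd I.1 :=
  congrArg Subtype.val (Module.Basis.span_apply (linearIndependent_bracketProd a n c) I)

/-- The action of matrices on the span of the products of `c` maximal minors. -/
noncomputable def spanAction (a c : ℕ) {n : ℕ} (g : Matrix (Fin n) (Fin n) ℚ) :
    bracketSpan a n c →ₗ[ℚ] bracketSpan a n c :=
  (columnAction g).toLinearMap.restrict fun p hp => by
    refine Submodule.span_induction (p := fun p _ => columnAction g p ∈ bracketSpan a n c)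
      ?_ ?_ ?_ ?_ hp
    · rintro _ ⟨I, rfl⟩
      exact columnAction_bracketProd_mem g I.1
    · simp
    · intro x y _ _ hx hy
      rw [map_add]
      exact Submodule.add_mem _ hx hy
    · intro r x _ hx
      rw [map_smul]
      exact Submodule.smul_mem _ r hx

theorem spanAction_mul (a c : ℕ) {n : ℕ} (g h : Matrix (Fin n) (Fin n) ℚ) :
    spanAction a c (g * h) = spanAction a c g * spanAction a c h := by
  apply LinearMap.ext
  intro x
  apply Subtype.ext
  exact (DFunLike.congr_fun (columnAction_mul g h) (x : MvPolynomial (Fin a ×ₗ Fin n) ℚ)).symm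

theorem trace_spanAction_eq_of_conj (a c : ℕ) {n : ℕ} {g h p q : Matrix (Fin n) (Fin n) ℚ}
    (hpq : p * q = 1) (hgh : g * p = p * h) :
    LinearMap.trace ℚ _ (spanAction a c g) = LinearMap.trace ℚ _ (spanAction a c h) := by
  have hg : g = p * (h * q) := by rw [← mul_assoc, ← hgh, mul_assoc, hpq, mul_one]
  rw [hg, spanAction_mul, LinearMap.trace_mul_comm, ← spanAction_mul, mul_assoc,
    mul_eq_one_comm.mp hpq, mul_one]

theorem LinearMap.trace_eq_sum_of_monomial {R M ι : Type*} [CommRing R] [AddCommGroup M]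
    [Module R M] [Fintype ι] [DecidableEq ι] (b : Module.Basis ι R M) (f : M →ₗ[R] M) (π : ι → ι)
    (d : ι → R) (hf : ∀ i, f (b i) = d i • b (π i)) :
    LinearMap.trace R M f = ∑ i, if π i = i then d i else 0 := by
  rw [LinearMap.trace_eq_matrix_trace R b, Matrix.trace]
  refine Finset.sum_congr rfl fun i _ => ?_
  rw [Matrix.diag_apply, LinearMap.toMatrix_apply, hf]
  simp [Finsupp.single_apply]

/-- The matrix sending the basis vector `e j` to `d j • e (π j)`. -/
def monomialMatrix {n : ℕ} (π : Fin n → Fin n) (d : Fin n → ℚ) : Matrix (Fin n) (Fin n) ℚ :=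
  Matrix.of fun i j => if i = π j then d j else 0

theorem monomialMatrix_mul {n : ℕ} (π τ : Fin n → Fin n) (d e : Fin n → ℚ) :
    monomialMatrix π d * monomialMatrix τ e =
      monomialMatrix (π ∘ τ) fun j => d (τ j) * e j := by
  ext i j
  simp [monomialMatrix, Matrix.mul_apply]

theorem monomialMatrix_id_one {n : ℕ} : monomialMatrix (id : Fin n → Fin n) 1 = 1 := by
  ext i j
  simp [monomialMatrix, Matrix.one_apply]

theorem columnAction_monomialMatrix {a n : ℕ} (π : Fin n → Fin n) (d : Fin n → ℚ)
    (I : Fin a → Fin n) :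
    columnAction (monomialMatrix π d) (bracket I) = (∏ i, d (I i)) • bracket (π ∘ I) := by
  rw [columnAction_bracket, Finset.sum_eq_single (π ∘ I)]
  · simp [monomialMatrix]
  · intro J _ hJ
    obtain ⟨i, hi⟩ := Function.ne_iff.mp hJ
    rw [Finset.prod_eq_zero (Finset.mem_univ i), zero_smul]
    exact if_neg hi
  · simp

/-- The antidiagonal permutation matrix and the diagonal matrix with alternating signs have the
same trace on products of maximal minors. -/
theorem trace_spanAction_rev (a c n : ℕ) :
    LinearMap.trace ℚ _ (spanAction a c (monomialMatrix (Fin.rev : Fin n → Fin n) 1)) =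
      LinearMap.trace ℚ _ (spanAction a c (monomialMatrix id fun j : Fin n => (-1) ^ (j : ℕ))) := by
  -- The eigenvalue signs of the reversal: `+1` on the first half including a middle index, `-1` on
  -- the rest.
  let ε : Fin n → ℚ := fun j => if 2 * (j : ℕ) < n then 1 else -1
  have hε : ∀ j, ε j * ε j = 1 := fun j => by
    simp only [ε]
    split_ifs <;> norm_num
  have hεr : ∀ j, ε j + ε j.rev = if j.rev = j then 2 else 0 := fun j => by
    simp only [ε, Fin.ext_iff, Fin.val_rev]
    split_ifs <;> first | omega | norm_num
  -- Sends the first half to the even positions and the second half to the odd ones, which turns `ε`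
  -- into alternating signs.
  let s : Fin n → Fin n := fun j =>
    ⟨if 2 * (j : ℕ) < n then 2 * j else 2 * (n - 1 - j) + 1, by split_ifs <;> omega⟩
  have hs : Function.Injective s := by
    intro i j hij
    simp only [s, Fin.mk.injEq] at hij
    ext
    split_ifs at hij <;> omega
  let σ : Equiv.Perm (Fin n) := Equiv.ofBijective s (Finite.injective_iff_bijective.mp hs)
  have hσ : ∀ j, (-1 : ℚ) ^ (s j : ℕ) = ε j := by
    intro j
    simp only [s, ε]
    split_ifs
    · simp
    · rw [pow_succ, pow_mul]
      simp
  have h1 : LinearMap.trace ℚ _ (spanAction a c (monomialMatrix (Fin.rev : Fin n → Fin n) 1)) =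
      LinearMap.trace ℚ _ (spanAction a c (monomialMatrix id ε)) := by
    -- For involutions `W` and `E`, the sum `p = W + E` satisfies `W p = 1 + W E = p E`. Here `p *
    -- p` is diagonal with entries `2`, or `4` at a middle index, so `p` is invertible.
    let p := monomialMatrix (Fin.rev : Fin n → Fin n) 1 + monomialMatrix id ε
    let e : Fin n → ℚ := fun j => if j.rev = j then 4 else 2
    have hpp : p * p = monomialMatrix id e := by
      simp only [p, mul_add, add_mul, monomialMatrix_mul]
      ext i j
      have h1 := hε j
      have h2 := hεr j
      simp only [monomialMatrix, e, Matrix.add_apply, Matrix.of_apply, Function.comp_apply, id,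
        Fin.rev_rev, Pi.one_apply, one_mul, mul_one]
      by_cases hj : j.rev = j
      · simp only [hj, if_true] at h2 ⊢
        split_ifs <;> linarith
      · simp only [hj, if_false] at h2 ⊢
        split_ifs <;> linarith
    refine trace_spanAction_eq_of_conj a c (p := p)
      (q := p * monomialMatrix id fun j => (e j)⁻¹) ?_ ?_
    · rw [← mul_assoc, hpp, monomialMatrix_mul, ← monomialMatrix_id_one]
      congr 1
      funext j
      simp only [e, id, Pi.one_apply]
      split_ifs <;> norm_num
    · simp only [p, mul_add, add_mul, monomialMatrix_mul]
      rw [add_comm]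
      congr 2
      · funext j
        simp
      · funext j
        simp [hε]
  rw [h1]
  refine trace_spanAction_eq_of_conj a c (p := monomialMatrix σ.symm 1)
    (q := monomialMatrix σ 1) ?_ ?_
  · rw [monomialMatrix_mul, ← monomialMatrix_id_one]
    congr 1
    · funext j
      simp
    · funext j
      simp
  · rw [monomialMatrix_mul, monomialMatrix_mul]
    congr 1
    funext j
    have : s (σ.symm j) = j := σ.apply_symm_apply j
    simp [← hσ, this]

theorem sign_revPerm (a : ℕ) :
    Equiv.Perm.sign (Fin.revPerm : Equiv.Perm (Fin a)) = (-1) ^ ∑ i : Fin a, (i : ℕ) := by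
  rw [Equiv.Perm.sign_eq_prod_prod_Iio, ← Finset.prod_pow_eq_pow_sum]
  refine Finset.prod_congr rfl fun j _ => ?_
  rw [Finset.prod_congr rfl (g := fun _ => -1), Finset.prod_const, Fin.card_Iio]
  intro i hi
  rw [Finset.mem_Iio] at hi
  simp [hi.le]

/-- Reversal of the order of a multichain. -/
def StdFamily.rev {a n c : ℕ} (I : StdFamily a n c) : StdFamily a n c :=
  ⟨fun k i => (I.1 k.rev i.rev).rev,
    fun _ _ _ hij => Fin.rev_lt_rev.mpr (I.2.1 _ (Fin.rev_lt_rev.mpr hij)),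
    fun _ _ hkl i => Fin.rev_le_rev.mpr (I.2.2 (Fin.rev_le_rev.mpr hkl) i.rev)⟩

-- Both sides are traces of conjugate matrices in the standard basis. Reversing the values of an
-- increasing tuple makes it decreasing, and re-sorting it costs the sign of the reversal, once for
-- each of the `c` factors.
open Classical in
theorem card_rev_eq_self (a n c : ℕ) :
    (-1 : ℚ) ^ (c * ∑ i : Fin a, (i : ℕ)) *
        (Finset.univ.filter fun I : StdFamily a n c => I.rev = I).card =
      ∑ I : StdFamily a n c, (-1 : ℚ) ^ ∑ k, ∑ i, (I.1 k i : ℕ) := by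
  have h := trace_spanAction_rev a c n
  rw [LinearMap.trace_eq_sum_of_monomial (stdBasis a n c) _ StdFamily.rev
      (fun _ => (-1 : ℚ) ^ (c * ∑ i : Fin a, (i : ℕ))),
    LinearMap.trace_eq_sum_of_monomial (stdBasis a n c) _ id
      (fun I => (-1 : ℚ) ^ ∑ k, ∑ i, (I.1 k i : ℕ))] at h
  · simp only [id, if_true] at h
    rw [← h, Finset.card_filter, Nat.cast_sum, Finset.mul_sum]
    exact Finset.sum_congr rfl fun I _ => by split_ifs <;> simp
  · intro I
    apply Subtype.ext
    rw [SetLike.val_smul, id, stdBasis_apply]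
    change columnAction _ (stdBasis a n c I : MvPolynomial (Fin a ×ₗ Fin n) ℚ) = _
    rw [stdBasis_apply, bracketProd, map_prod]
    simp only [columnAction_monomialMatrix, Finset.prod_smul, Function.id_comp,
      Finset.prod_pow_eq_pow_sum]
  · intro I
    apply Subtype.ext
    rw [SetLike.val_smul, stdBasis_apply]
    change columnAction _ (stdBasis a n c I : MvPolynomial (Fin a ×ₗ Fin n) ℚ) = _
    rw [stdBasis_apply, bracketProd, map_prod, bracketProd, ← Equiv.prod_comp Fin.revPerm]
    have hk : ∀ k, columnAction (monomialMatrix Fin.rev 1) (bracket (I.1 (Fin.revPerm k))) =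
        (-1 : ℚ) ^ (∑ i : Fin a, (i : ℕ)) • bracket (I.rev.1 k) := by
      intro k
      have e : I.rev.1 k = (Fin.rev ∘ I.1 (Fin.revPerm k)) ∘ (Fin.revPerm : Equiv.Perm (Fin a)) :=
        rfl
      rw [columnAction_monomialMatrix, e, bracket_comp_perm, sign_revPerm, smul_smul]
      simp [← mul_pow]
    simp only [hk]
    rw [Finset.prod_smul, Finset.prod_const, Finset.card_univ, Fintype.card_fin, ← pow_mul, mul_comm]

/-! ### Plane partitions as index multichains of standard monomials. -/

theorem mem_iff_lt_card_of_isLowerSet {b : ℕ} {s : Finset (Fin b)}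
    (hs : IsLowerSet (s : Set (Fin b))) (j : Fin b) : j ∈ s ↔ (j : ℕ) < s.card := by
  constructor
  · intro hj
    have : Finset.Iic j ⊆ s := fun x hx => hs (Finset.mem_Iic.mp hx) hj
    have := Finset.card_le_card this
    rw [Fin.card_Iic] at this
    omega
  · intro hj
    by_contra hjs
    have : s ⊆ Finset.Iio j := by
      intro x hx
      rw [Finset.mem_Iio]
      by_contra hxj
      exact hjs (hs (not_lt.mp hxj) hx)
    have := Finset.card_le_card this
    rw [Fin.card_Iio] at this
    omega

/-- Weakly decreasing `a × c` arrays with entries at most `b`. -/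
abbrev HeightArray (a b c : ℕ) : Type :=
  {h : Fin a → Fin c → ℕ // (∀ i k, h i k ≤ b) ∧
    ∀ i i' k k', i ≤ i' → k ≤ k' → h i' k' ≤ h i k}

namespace PlanePartition

variable {a b c : ℕ}

/-- The number of cubes of a plane partition in a column in the second direction. -/
def height (T : PlanePartition a b c) (i : Fin a) (k : Fin c) : ℕ :=
  (Finset.univ.filter fun j => (i, j, k) ∈ T.1).card

theorem mem_iff_lt_height (T : PlanePartition a b c) (i : Fin a) (j : Fin b) (k : Fin c) :
    (i, j, k) ∈ T.1 ↔ (j : ℕ) < T.height i k := by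
  rw [height, ← mem_iff_lt_card_of_isLowerSet]
  · simp
  · intro x y hyx hx
    simp only [Finset.coe_filter, Finset.mem_univ, true_and, Set.mem_ofPred_eq] at hx ⊢
    exact T.2 (show (i, y, k) ≤ (i, x, k) from ⟨le_rfl, hyx, le_rfl⟩) hx

theorem height_le (T : PlanePartition a b c) (i : Fin a) (k : Fin c) : T.height i k ≤ b :=
  (Finset.card_le_univ _).trans_eq (Fintype.card_fin b)

theorem height_anti (T : PlanePartition a b c) {i i' : Fin a} {k k' : Fin c} (hi : i ≤ i')
    (hk : k ≤ k') : T.height i' k' ≤ T.height i k := by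
  apply Finset.card_le_card
  intro j hj
  simp only [Finset.mem_filter, Finset.mem_univ, true_and] at hj ⊢
  exact T.2 (show (i, j, k) ≤ (i', j, k') from ⟨hi, le_rfl, hk⟩) hj

theorem size_eq_sum_height (T : PlanePartition a b c) : T.size = ∑ i, ∑ k, T.height i k := by
  have h : T.1 = Finset.univ.filter fun x => x ∈ T.1 := by simp
  rw [size, h, Finset.card_filter, Fintype.sum_prod_type]
  refine Finset.sum_congr rfl fun i _ => ?_
  rw [Fintype.sum_prod_type_right]
  exact Finset.sum_congr rfl fun k _ => (Finset.card_filter _ _).symm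

theorem mem_compl_iff (T : PlanePartition a b c) (x : Fin a × Fin b × Fin c) :
    x ∈ T.compl.1 ↔ boxRev a b c x ∉ T.1 := by
  simp only [compl, Finset.mem_image, Finset.mem_compl]
  constructor
  · rintro ⟨y, hy, rfl⟩
    rwa [boxRev_boxRev]
  · exact fun h => ⟨_, h, boxRev_boxRev a b c x⟩

theorem height_compl (T : PlanePartition a b c) (i : Fin a) (k : Fin c) :
    T.compl.height i k = b - T.height i.rev k.rev := by
  have h := Finset.card_filter_add_card_filter_not (s := (Finset.univ : Finset (Fin b)))
    (fun j => (i.rev, j, k.rev) ∈ T.1)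
  have h' : T.compl.height i k =
      (Finset.univ.filter fun j => (i.rev, j, k.rev) ∉ T.1).card := by
    rw [height]
    refine Finset.card_equiv Fin.revPerm fun j => ?_
    simp [mem_compl_iff, boxRev]
  rw [Finset.card_univ, Fintype.card_fin] at h
  rw [h', height]
  omega

/-- Plane partitions as arrays of heights. -/
def equivHeightArray (a b c : ℕ) : PlanePartition a b c ≃ HeightArray a b c where
  toFun T := ⟨T.height, T.height_le, fun _ _ _ _ hi hk => T.height_anti hi hk⟩
  invFun h := ⟨Finset.univ.filter fun x => (x.2.1 : ℕ) < h.1 x.1 x.2.2, by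
    intro x y hyx hx
    simp only [Finset.coe_filter, Finset.mem_univ, true_and, Set.mem_ofPred_eq] at hx ⊢
    have h1 := h.2.2 _ _ _ _ hyx.1 hyx.2.2
    have h2 : (y.2.1 : ℕ) ≤ x.2.1 := hyx.2.1
    omega⟩
  left_inv T := by
    apply Subtype.ext
    ext ⟨i, j, k⟩
    simp [mem_iff_lt_height]
  right_inv h := by
    apply Subtype.ext
    funext i k
    simp only [height, Finset.mem_filter, Finset.mem_univ, true_and]
    have : (Finset.univ.filter fun j : Fin b => (j : ℕ) < h.1 i k).card =
        Fintype.card (Fin (h.1 i k)) := by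
      rw [← Fintype.card_subtype]
      exact Fintype.card_congr
        { toFun := fun j => ⟨j.1, j.2⟩
          invFun := fun j => ⟨⟨j, j.2.trans_le (h.2.1 i k)⟩, j.2⟩
          left_inv := fun j => rfl
          right_inv := fun j => rfl }
    rw [this, Fintype.card_fin]

noncomputable instance : Fintype (PlanePartition a b c) := by
  classical
  exact Subtype.fintype fun T : Finset (Fin a × Fin b × Fin c) =>
    IsLowerSet (T : Set (Fin a × Fin b × Fin c))

end PlanePartition

theorem StrictMono.add_sub_le_val {a n : ℕ} {f : Fin a → Fin n} (hf : StrictMono f) {i j : Fin a}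
    (hij : i ≤ j) : (f i : ℕ) + (j - i) ≤ f j := by
  obtain ⟨i, hi⟩ := i
  obtain ⟨j, hj⟩ := j
  obtain ⟨d, rfl⟩ := Nat.exists_eq_add_of_le (show i ≤ j from hij)
  induction d with
  | zero => simp
  | succ d ih =>
    have h1 := ih (by omega) (show i ≤ i + d by omega)
    have h2 : (f ⟨i + d, by omega⟩ : ℕ) < f ⟨i + (d + 1), hj⟩ :=
      hf (show i + d < i + (d + 1) by omega)
    simp only at h1 ⊢
    omega

theorem StrictMono.val_le_val {a n : ℕ} {f : Fin a → Fin n} (hf : StrictMono f) (i : Fin a) :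
    (i : ℕ) ≤ f i := by
  have h := hf.add_sub_le_val (i := ⟨0, i.pos⟩) (j := i) (Nat.zero_le _)
  simp only at h
  omega

theorem StrictMono.val_le_add {a b : ℕ} {f : Fin a → Fin (a + b)} (hf : StrictMono f)
    (i : Fin a) : (f i : ℕ) ≤ i + b := by
  have hi := i.2
  have h := hf.add_sub_le_val (i := i) (j := ⟨a - 1, by omega⟩) (show (i : ℕ) ≤ a - 1 by omega)
  have := (f ⟨a - 1, by omega⟩).2
  simp only at h
  omega

/-- Arrays of heights as multichains of tuples. -/
def HeightArray.equivStdFamily (a b c : ℕ) : HeightArray a b c ≃ StdFamily a (a + b) c where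
  -- Reversing the indices makes the heights increase, and adding `i` makes them strictly increasing
  -- in `i`.
  toFun h := ⟨fun k i => ⟨i + h.1 i.rev k.rev, by have := h.2.1 i.rev k.rev; omega⟩,
    fun k i j hij => by
      have h1 := h.2.2 _ _ k.rev k.rev (Fin.rev_le_rev.mpr hij.le) le_rfl
      have h2 : (i : ℕ) < j := hij
      exact Fin.mk_lt_mk.mpr (by omega),
    fun k l hkl i => by
      have h1 := h.2.2 i.rev i.rev _ _ le_rfl (Fin.rev_le_rev.mpr hkl)
      exact Fin.mk_le_mk.mpr (by omega)⟩
  invFun I := ⟨fun i k => I.1 k.rev i.rev - (i.rev : ℕ),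
    fun i k => by have := (I.2.1 k.rev).val_le_add i.rev; dsimp only; omega,
    fun i i' k k' hi hk => by
      have h1 : (i'.rev : ℕ) ≤ i.rev := Fin.rev_le_rev.mpr hi
      have h2 := (I.2.1 k'.rev).add_sub_le_val (Fin.rev_le_rev.mpr hi)
      have h3 : (I.1 k'.rev i.rev : ℕ) ≤ I.1 k.rev i.rev := I.2.2 (Fin.rev_le_rev.mpr hk) i.rev
      dsimp only
      omega⟩
  left_inv h := by
    apply Subtype.ext
    funext i k
    simp
  right_inv I := by
    apply Subtype.ext
    funext k i
    apply Fin.ext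
    have := (I.2.1 k).val_le_val i
    simp only [Fin.rev_rev]
    omega

-- The trace identity for `n = a + b`, transported to plane partitions. The entries of a multichain
-- sum to `|T|` plus the constant `c * ∑ i`, whose sign is exactly the one produced by the reversal
-- and cancels.
open Classical in
theorem numSelfCompl_eq_sum (a b c : ℕ) :
    (numSelfCompl a b c : ℚ) = ∑ T : PlanePartition a b c, (-1 : ℚ) ^ T.size := by
  let e := (PlanePartition.equivHeightArray a b c).trans (HeightArray.equivStdFamily a b c)
  have he : ∀ T k i, (((e T).1 k i : Fin (a + b)) : ℕ) = i + T.height i.rev k.rev :=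
    fun _ _ _ => rfl
  have hsum : ∀ T, ∑ k, ∑ i, ((e T).1 k i : ℕ) = c * ∑ i : Fin a, (i : ℕ) + T.size := by
    intro T
    simp only [he, Finset.sum_add_distrib, Finset.sum_const, Finset.card_univ, Fintype.card_fin,
      smul_eq_mul]
    rw [T.size_eq_sum_height, Finset.sum_comm]
    congr 1
    rw [← Equiv.sum_comp Fin.revPerm (fun i => ∑ k, T.height i k)]
    exact Finset.sum_congr rfl fun i _ => Equiv.sum_comp Fin.revPerm (fun k => T.height i.rev k)
  have hrev : ∀ T, (e T).rev = e T ↔ T.compl = T := by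
    intro T
    rw [← e.apply_eq_iff_eq]
    -- With `h` the height at `(i, k.rev)`, the reversed entry is `(a + b - 1) - ((a - 1 - i) + h) =
    -- i + (b - h)`.
    have : (e T).rev = e T.compl := by
      apply Subtype.ext
      funext k i
      apply Fin.ext
      rw [he, T.height_compl]
      change (((e T).1 k.rev i.rev).rev : ℕ) = _
      rw [Fin.val_rev, he]
      have := T.height_le i.rev.rev k.rev.rev
      have := i.2
      rw [Fin.val_rev]
      omega
    rw [this]
  have hcard : (Finset.univ.filter fun I : StdFamily a (a + b) c => I.rev = I).card =
      numSelfCompl a b c := by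
    rw [numSelfCompl, Nat.card_congr (e.subtypeEquiv (q := fun I => I.rev = I) fun T =>
      (hrev T).symm), Nat.card_eq_fintype_card, Fintype.card_subtype]
  have h := card_rev_eq_self a (a + b) c
  rw [hcard, ← Equiv.sum_comp e] at h
  simp only [hsum, pow_add, ← Finset.mul_sum] at h
  exact mul_left_cancel₀ (by simp) h

/-! ### Vandermonde determinants as sums over Gelfand–Tsetlin patterns. -/

/-- The Vandermonde determinant in the powers `q ^ (l i + i)`. -/
noncomputable def shiftedVandermonde {R : Type*} [CommRing R] (q : R) (n : ℕ) (l : ℕ → ℕ) : R :=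
  (Matrix.vandermonde fun i : Fin n => q ^ (l i + i)).det

/-- Extension of a tuple by zero. -/
def extendTuple (n : ℕ) : (Fin n → ℕ) ↪ (ℕ → ℕ) where
  toFun m i := if h : i < n then m ⟨i, h⟩ else 0
  inj' m m' h := by
    funext i
    simpa using congrFun h i

theorem extendTuple_apply (n : ℕ) (m : Fin n → ℕ) (i : ℕ) :
    extendTuple n m i = if h : i < n then m ⟨i, h⟩ else 0 :=
  rfl

/-- The rows of length `n` interlacing a row `l` of length `n + 1`. -/
def interlacingRows (n : ℕ) (l : ℕ → ℕ) : Finset (ℕ → ℕ) :=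
  (Fintype.piFinset fun i : Fin n => Finset.Ico (l i) (l (i + 1) + 1)).map (extendTuple n)

theorem mem_interlacingRows {n : ℕ} {l m : ℕ → ℕ} :
    m ∈ interlacingRows n l ↔
      (∀ i < n, l i ≤ m i ∧ m i ≤ l (i + 1)) ∧ ∀ i, n ≤ i → m i = 0 := by
  simp only [interlacingRows, Finset.mem_map, Fintype.mem_piFinset, Finset.mem_Ico]
  constructor
  · rintro ⟨μ, hμ, rfl⟩
    refine ⟨fun i hi => ?_, fun i hi => ?_⟩
    · have := hμ ⟨i, hi⟩
      simp only [extendTuple_apply, dif_pos hi]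
      dsimp only at this
      omega
    · simp only [extendTuple_apply, dif_neg (not_lt.mpr hi)]
  · rintro ⟨h1, h2⟩
    refine ⟨fun i => m i, fun i => ⟨(h1 i i.2).1, Nat.lt_succ_of_le (h1 i i.2).2⟩, ?_⟩
    · funext i
      by_cases hi : i < n
      · simp [extendTuple_apply, hi]
      · simp [extendTuple_apply, hi, h2 i (not_lt.mp hi)]

/-- A geometric sum of ratio `q ^ (j + 1)`. It turns the difference of consecutive Vandermonde rows
into a sum over the values an interlacing entry can take. -/
theorem pow_sub_pow_eq_sum_Ico {R : Type*} [CommRing R] (q : R) {x y : ℕ} (hxy : x ≤ y)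
    (i j : ℕ) :
    (q ^ (y + (i + 1))) ^ (j + 1) - (q ^ (x + i)) ^ (j + 1) =
      (q ^ (j + 1) - 1) * ∑ m ∈ Finset.Ico x (y + 1), (q ^ (m + i)) ^ (j + 1) := by
  have h := geom_sum_Ico_mul (q ^ (j + 1)) (show x ≤ y + 1 by omega)
  have h' : ∑ m ∈ Finset.Ico x (y + 1), (q ^ (m + i)) ^ (j + 1) =
      (q ^ (j + 1)) ^ i * ∑ m ∈ Finset.Ico x (y + 1), (q ^ (j + 1)) ^ m := by
    rw [Finset.mul_sum]
    exact Finset.sum_congr rfl fun m _ => by ring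
  rw [h', mul_comm, mul_assoc, h]
  ring

/-- The branching rule for the principal specialization of Schur polynomials. -/
theorem shiftedVandermonde_succ {R : Type*} [CommRing R] (q : R) (n : ℕ) {l : ℕ → ℕ}
    (hl : ∀ i < n, l i ≤ l (i + 1)) :
    shiftedVandermonde q (n + 1) l =
      (∏ j ∈ Finset.range n, (q ^ (j + 1) - 1) * q ^ j) *
        ∑ m ∈ interlacingRows n l, q ^ (∑ i ∈ Finset.range n, m i) * shiftedVandermonde q n m := by
  -- Subtracting from each row its predecessor leaves the first column `(1, 0, …, 0)`, so the
  -- determinant drops to size `n`.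
  let B : Matrix (Fin (n + 1)) (Fin (n + 1)) R := Matrix.of fun i j =>
    Fin.cases ((q ^ (l 0 + 0)) ^ (j : ℕ))
      (fun i : Fin n => (q ^ (l (i + 1) + (i + 1))) ^ (j : ℕ) - (q ^ (l i + i)) ^ (j : ℕ)) i
  have h1 : shiftedVandermonde q (n + 1) l = B.det := by
    apply Matrix.det_eq_of_forall_row_eq_smul_add_pred (fun _ => 1)
    · intro j
      simp [B, Matrix.vandermonde_apply]
    · intro i j
      simp [B, Matrix.vandermonde_apply]
  have h2 : B.det = (Matrix.of fun i j : Fin n =>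
      (q ^ (l (i + 1) + (i + 1))) ^ (j + 1 : ℕ) - (q ^ (l i + i)) ^ (j + 1 : ℕ)).det := by
    rw [Matrix.det_succ_column_zero, Fin.sum_univ_succ, Finset.sum_eq_zero]
    · simp only [B, Matrix.of_apply, Fin.cases_zero, Fin.val_zero, pow_zero, one_mul, add_zero]
      congr 1
    · intro i _
      simp [B]
  have h3 : (Matrix.of fun i j : Fin n =>
      (q ^ (l (i + 1) + (i + 1))) ^ (j + 1 : ℕ) - (q ^ (l i + i)) ^ (j + 1 : ℕ)) =
      Matrix.of fun i j : Fin n => (q ^ (j + 1 : ℕ) - 1) *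
        (Matrix.of (fun i j : Fin n =>
          ∑ m ∈ Finset.Ico (l i) (l (i + 1) + 1), (q ^ (m + i)) ^ (j + 1 : ℕ))) i j := by
    ext i j
    simp only [Matrix.of_apply]
    exact pow_sub_pow_eq_sum_Ico q (hl i i.2) i j
  have h4 : (Matrix.of (fun i j : Fin n =>
      ∑ m ∈ Finset.Ico (l i) (l (i + 1) + 1), (q ^ (m + i)) ^ (j + 1 : ℕ))).det =
      ∑ m ∈ Fintype.piFinset fun i : Fin n => Finset.Ico (l i) (l (i + 1) + 1),
        (Matrix.of fun i j : Fin n => (q ^ (m i + i)) ^ (j + 1 : ℕ)).det := by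
    have := (Matrix.detRowAlternating (R := R) (n := Fin n)).toMultilinearMap.map_sum_finset
      (fun (i : Fin n) (m : ℕ) (j : Fin n) => (q ^ (m + i)) ^ (j + 1 : ℕ))
      (fun i : Fin n => Finset.Ico (l i) (l (i + 1) + 1))
    refine Eq.trans ?_ this
    change Matrix.det _ = Matrix.det _
    congr 1
    ext i j
    simp [Finset.sum_apply]
  rw [h1, h2, h3, Matrix.det_mul_row, h4, interlacingRows, Finset.sum_map, Finset.prod_mul_distrib,
    mul_assoc, Finset.prod_range (fun j => q ^ (j + 1) - 1)]
  congr 1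
  rw [Finset.mul_sum]
  refine Finset.sum_congr rfl fun m _ => ?_
  -- The exponents start at `1`, so each row releases a factor `q ^ (m i + i)`: its `m i` part is
  -- the weight of the row `m`, its `i` part goes into the prefactor.
  have h5 : (Matrix.of fun i j : Fin n => (q ^ (m i + i)) ^ (j + 1 : ℕ)) =
      Matrix.of fun i j : Fin n => q ^ (m i + i) *
        (Matrix.vandermonde (fun i : Fin n => q ^ (extendTuple n m i + i))) i j := by
    ext i j
    simp [Matrix.vandermonde_apply, pow_succ', extendTuple_apply]
  rw [h5, Matrix.det_mul_column, shiftedVandermonde, ← mul_assoc, Finset.sum_range,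
    Finset.prod_range, ← Finset.prod_pow_eq_pow_sum, ← Finset.prod_mul_distrib]
  congr 1
  refine Finset.prod_congr rfl fun i _ => ?_
  simp [extendTuple_apply, pow_add, mul_comm]

/-- Gelfand–Tsetlin patterns with top row `l` of length `n`. Row `d < n` has length `d`. -/
noncomputable def gtPatterns : ℕ → (ℕ → ℕ) → Finset (ℕ → ℕ → ℕ)
  | 0, _ => {0}
  | n + 1, l => open Classical in
    ((interlacingRows n l).sigma fun m => gtPatterns n m).image
      fun p => Function.update p.2 n p.1

/-- The recursion unrolled into inequalities. A pattern does not store its top row: `x n` is zero,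
and `Function.update x n l` puts `l` back. -/
theorem mem_gtPatterns {n : ℕ} {l : ℕ → ℕ} {x : ℕ → ℕ → ℕ} :
    x ∈ gtPatterns n l ↔
      (∀ d i, n ≤ d ∨ d ≤ i → x d i = 0) ∧
      ∀ d i, i < d → d < n → Function.update x n l (d + 1) i ≤ x d i ∧
        x d i ≤ Function.update x n l (d + 1) (i + 1) := by
  classical
  induction n generalizing l x with
  | zero =>
    simp only [gtPatterns, Finset.mem_singleton]
    constructor
    · rintro rfl
      simp
    · rintro ⟨h, -⟩
      funext d i
      exact h d i (.inl (Nat.zero_le d))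
  | succ n ih =>
    simp only [gtPatterns, Finset.mem_image, Finset.mem_sigma, Sigma.exists, ih,
      mem_interlacingRows]
    constructor
    · rintro ⟨m, x, ⟨⟨hm1, hm2⟩, hx1, hx2⟩, rfl⟩
      refine ⟨fun d i hdi => ?_, fun d i hid hd => ?_⟩
      · by_cases hdn : d = n
        · subst hdn
          rw [Function.update_self]
          exact hm2 i (by omega)
        · rw [Function.update_of_ne hdn]
          exact hx1 d i (by omega)
      · by_cases hdn : d = n
        · subst hdn
          rw [Function.update_self, Function.update_self]
          exact hm1 i hid
        · rw [Function.update_of_ne hdn, Function.update_of_ne (a := d + 1) (by omega)]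
          exact hx2 d i hid (by omega)
    · rintro ⟨h1, h2⟩
      refine ⟨x n, Function.update x n 0, ⟨⟨fun i hi => ?_, fun i hi => h1 n i (.inr hi)⟩,
        fun d i hdi => ?_, fun d i hid hd => ?_⟩, ?_⟩
      · simpa using h2 n i hi (by omega)
      · by_cases hdn : d = n
        · simp [hdn]
        · rw [Function.update_of_ne hdn]
          exact h1 d i (by omega)
      · rw [Function.update_idem, Function.update_eq_self, Function.update_of_ne (a := d) (by omega)]
        have := h2 d i hid (by omega)
        rwa [Function.update_of_ne (a := d + 1) (by omega)] at this
      · rw [Function.update_idem, Function.update_eq_self]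

/-- The sum of the entries of a pattern below the top row of length `n`. -/
def patternSum (n : ℕ) (x : ℕ → ℕ → ℕ) : ℕ :=
  ∑ d ∈ Finset.range n, ∑ i ∈ Finset.range d, x d i

/-- The branching rule iterated down to the empty row; interlacing keeps each successive row
monotone. -/
theorem shiftedVandermonde_eq_sum {R : Type*} [CommRing R] (q : R) (n : ℕ) {l : ℕ → ℕ}
    (hl : ∀ i, i + 1 < n → l i ≤ l (i + 1)) :
    shiftedVandermonde q n l =
      (∏ k ∈ Finset.range n, ∏ j ∈ Finset.range k, (q ^ (j + 1) - 1) * q ^ j) *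
        ∑ x ∈ gtPatterns n l, q ^ patternSum n x := by
  classical
  induction n generalizing l with
  | zero => simp [shiftedVandermonde, gtPatterns, patternSum]
  | succ n ih =>
    rw [shiftedVandermonde_succ q n fun i hi => hl i (by omega), Finset.prod_range_succ, gtPatterns,
      Finset.sum_image, Finset.sum_sigma,
      mul_comm (∏ k ∈ Finset.range n, ∏ j ∈ Finset.range k, _), mul_assoc]
    · congr 1
      rw [Finset.mul_sum]
      refine Finset.sum_congr rfl fun m hm => ?_
      rw [mem_interlacingRows] at hm
      rw [ih fun i hi => (hm.1 i (by omega)).2.trans (hm.1 (i + 1) hi).1, mul_left_comm,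
        Finset.mul_sum]
      congr 1
      refine Finset.sum_congr rfl fun x _ => ?_
      rw [← pow_add, patternSum, patternSum, Finset.sum_range_succ, Function.update_self, add_comm]
      congr 2
      refine Finset.sum_congr rfl fun d hd => ?_
      rw [Function.update_of_ne (Finset.mem_range.mp hd).ne]
    · rintro ⟨m, x⟩ hx ⟨m', x'⟩ hx' h
      simp only [Finset.coe_sigma, Set.mem_sigma_iff, Finset.mem_coe, mem_gtPatterns] at hx hx' h
      have hm : m = m' := by simpa using congrFun h n
      subst hm
      have hxx : x = x' := by
        funext d
        by_cases hd : d = n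
        · funext i
          rw [hx.2.1 d i (.inl hd.ge), hx'.2.1 d i (.inl hd.ge)]
        · simpa [hd] using congrFun h d
      rw [hxx]

/-! ### Patterns with rectangular top row are plane partitions. -/

/-- The row `(0, …, 0, b, b, …)` with `c` zeros. -/
def rectRow (b c i : ℕ) : ℕ := if c ≤ i then b else 0

/-- A pattern with its top row adjoined, in the coordinates in which it is increasing in the first
and decreasing in the second argument. -/
def patternEntry (n : ℕ) (l : ℕ → ℕ) (x : ℕ → ℕ → ℕ) (i u : ℕ) : ℕ :=
  Function.update x n l (i + u + 1) i

theorem patternEntry_anti {n : ℕ} {l : ℕ → ℕ} {x : ℕ → ℕ → ℕ} (hx : x ∈ gtPatterns n l)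
    {i u u' : ℕ} (hu : u ≤ u') (h : i + u' < n) :
    patternEntry n l x i u' ≤ patternEntry n l x i u := by
  induction u', hu using Nat.le_induction with
  | base => exact le_rfl
  | succ u' hu ih =>
    refine le_trans ?_ (ih (by omega))
    have := ((mem_gtPatterns.mp hx).2 (i + u' + 1) i (by omega) (by omega)).1
    rwa [← Function.update_of_ne (f := x) (a := i + u' + 1) (a' := n) (by omega) l] at this

theorem patternEntry_mono {n : ℕ} {l : ℕ → ℕ} {x : ℕ → ℕ → ℕ} (hx : x ∈ gtPatterns n l)
    {i i' u : ℕ} (hi : i ≤ i') (h : i' + u < n) :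
    patternEntry n l x i u ≤ patternEntry n l x i' u := by
  induction i', hi using Nat.le_induction with
  | base => exact le_rfl
  | succ i' hi ih =>
    refine le_trans (ih (by omega)) ?_
    have := ((mem_gtPatterns.mp hx).2 (i' + u + 1) i' (by omega) (by omega)).2
    rw [← Function.update_of_ne (f := x) (a := i' + u + 1) (a' := n) (by omega) l] at this
    rwa [patternEntry, patternEntry, show i' + 1 + u + 1 = i' + u + 1 + 1 by ring]

theorem patternEntry_top {n : ℕ} {l : ℕ → ℕ} {x : ℕ → ℕ → ℕ} {i u : ℕ} (h : i + u + 1 = n) :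
    patternEntry n l x i u = l i := by
  rw [patternEntry, h, Function.update_self]

theorem patternEntry_of_lt {n : ℕ} {l : ℕ → ℕ} {x : ℕ → ℕ → ℕ} {i u : ℕ} (h : i + u + 1 < n) :
    patternEntry n l x i u = x (i + u + 1) i := by
  rw [patternEntry, Function.update_of_ne h.ne]

theorem patternEntry_le {n b c : ℕ} {x : ℕ → ℕ → ℕ} (hx : x ∈ gtPatterns n (rectRow b c))
    {i u : ℕ} (h : i + u < n) : patternEntry n (rectRow b c) x i u ≤ b := by
  refine (patternEntry_mono hx (i' := n - 1 - u) (by omega) (by omega)).trans ?_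
  rw [patternEntry_top (by omega), rectRow]
  split_ifs <;> omega

namespace PlanePartition

variable {a b c : ℕ}

/-- Heights extended by zero. -/
def heightNat (T : PlanePartition a b c) (u k : ℕ) : ℕ :=
  if h : u < a ∧ k < c then T.height ⟨u, h.1⟩ ⟨k, h.2⟩ else 0

theorem heightNat_apply (T : PlanePartition a b c) (u : Fin a) (k : Fin c) :
    T.heightNat u k = T.height u k := by
  simp [heightNat]

theorem heightNat_le (T : PlanePartition a b c) (u k : ℕ) : T.heightNat u k ≤ b := by
  rw [heightNat]
  split_ifs
  · exact T.height_le _ _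
  · exact Nat.zero_le b

theorem heightNat_anti (T : PlanePartition a b c) {u u' k k' : ℕ} (hu : u ≤ u') (hk : k ≤ k') :
    T.heightNat u' k' ≤ T.heightNat u k := by
  by_cases h : u' < a ∧ k' < c
  · rw [heightNat, dif_pos h, heightNat, dif_pos (by omega)]
    exact T.height_anti hu hk
  · rw [heightNat, dif_neg h]
    exact Nat.zero_le _

/-- The entries of the pattern of a plane partition. -/
def rectEntry (T : PlanePartition a b c) (i u : ℕ) : ℕ :=
  if c ≤ i then b else T.heightNat u (c - 1 - i)

/-- The Gelfand–Tsetlin pattern of a plane partition. -/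
def toPattern (T : PlanePartition a b c) (d i : ℕ) : ℕ :=
  if c + a ≤ d ∨ d ≤ i then 0 else T.rectEntry i (d - 1 - i)

theorem update_toPattern (T : PlanePartition a b c) {d i : ℕ} (hd : d ≤ c + a) (hi : i < d) :
    Function.update T.toPattern (c + a) (rectRow b c) d i = T.rectEntry i (d - 1 - i) := by
  by_cases h : d = c + a
  · subst h
    rw [Function.update_self, rectRow, rectEntry]
    split_ifs
    · rfl
    · rw [heightNat, dif_neg (by omega)]
  · rw [Function.update_of_ne h, toPattern, if_neg (by omega)]

theorem toPattern_mem (T : PlanePartition a b c) :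
    T.toPattern ∈ gtPatterns (c + a) (rectRow b c) := by
  rw [mem_gtPatterns]
  refine ⟨fun d i h => if_pos h, fun d i hi hd => ?_⟩
  rw [T.update_toPattern (by omega) (by omega), T.update_toPattern (by omega) (by omega), toPattern,
    if_neg (by omega)]
  simp only [rectEntry]
  constructor
  · split_ifs
    · exact le_rfl
    · exact T.heightNat_anti (by omega) le_rfl
  · split_ifs
    · exact le_rfl
    · omega
    · exact T.heightNat_le _ _
    · exact T.heightNat_anti (by omega) (by omega)

theorem toPattern_apply (T : PlanePartition a b c) (u : Fin a) (k : Fin c) :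
    T.toPattern (c - 1 - k + u + 1) (c - 1 - k) = T.height u k := by
  have hu := u.2
  have hk := k.2
  rw [toPattern, if_neg (by omega), rectEntry, if_neg (by omega),
    show c - 1 - k + u + 1 - 1 - (c - 1 - k) = u by omega,
    show c - 1 - (c - 1 - k) = (k : ℕ) by omega, heightNat_apply]

theorem toPattern_injective :
    Function.Injective (toPattern : PlanePartition a b c → ℕ → ℕ → ℕ) := by
  intro T T' h
  apply (equivHeightArray a b c).injective
  apply Subtype.ext
  funext u k
  change T.height u k = T'.height u k
  rw [← toPattern_apply, ← toPattern_apply, h]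

/-- In the coordinates `(i, u)`, the entries `b` of the top row force the value `b` for `i ≥ c`, and
its zeros force `0` for `i < c`, `u ≥ a`. What remains free is a `c × a` rectangle, the array of
heights. -/
theorem exists_toPattern_eq {x : ℕ → ℕ → ℕ} (hx : x ∈ gtPatterns (c + a) (rectRow b c)) :
    ∃ T : PlanePartition a b c, T.toPattern = x := by
  let y := patternEntry (c + a) (rectRow b c) x
  have hxy : ∀ i u, i + u + 1 < c + a → y i u = x (i + u + 1) i := fun i u h =>
    patternEntry_of_lt h
  let h : HeightArray a b c := ⟨fun u k => y (c - 1 - k) u, fun u k => by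
      have hu := u.2
      have hk := k.2
      exact patternEntry_le hx (by omega),
    fun u u' k k' hu hk => by
      have hu' := u'.2
      have hk' := k.2
      have h1 : (u : ℕ) ≤ u' := hu
      have h2 : (k : ℕ) ≤ k' := hk
      exact (patternEntry_anti hx h1 (by omega)).trans
        (patternEntry_mono hx (by omega) (by omega))⟩
  let T := (equivHeightArray a b c).symm h
  have hT : ∀ u k, T.height u k = y (c - 1 - k) u := fun u k =>
    congrFun (congrFun (congrArg Subtype.val ((equivHeightArray a b c).apply_symm_apply h)) u) k
  refine ⟨T, ?_⟩
  funext d i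
  by_cases hdi : c + a ≤ d ∨ d ≤ i
  · rw [toPattern, if_pos hdi, (mem_gtPatterns.mp hx).1 d i hdi]
  · push Not at hdi
    obtain ⟨u, rfl⟩ := Nat.exists_eq_add_of_lt hdi.2
    rw [toPattern, if_neg (by omega), rectEntry, show i + u + 1 - 1 - i = u by omega,
      ← hxy i u hdi.1]
    split_ifs with hc
    · apply le_antisymm _ (patternEntry_le hx (by omega))
      have h1 := patternEntry_anti hx (i := i) (u := u) (u' := c + a - 1 - i) (by omega) (by omega)
      rwa [patternEntry_top (by omega), rectRow, if_pos hc] at h1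
    · by_cases hu : u < a
      · rw [heightNat, dif_pos (by omega), hT]
        simp only
        rw [show c - 1 - (c - 1 - i) = i by omega]
      · rw [heightNat, dif_neg (by omega)]
        symm
        rw [← Nat.le_zero]
        refine (patternEntry_mono hx (i' := c + a - 1 - u) (by omega) (by omega)).trans ?_
        rw [patternEntry_top (by omega), rectRow, if_neg (by omega)]

end PlanePartition

theorem sum_range_triangle (f : ℕ → ℕ → ℕ) (n : ℕ) :
    ∑ d ∈ Finset.range n, ∑ i ∈ Finset.range d, f i (d - 1 - i) =
      ∑ i ∈ Finset.range n, ∑ u ∈ Finset.range (n - 1 - i), f i u := by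
  rw [Finset.sum_sigma', Finset.sum_sigma']
  refine Finset.sum_bij' (fun p _ => ⟨p.2, p.1 - 1 - p.2⟩) (fun p _ => ⟨p.1 + p.2 + 1, p.1⟩)
    ?_ ?_ ?_ ?_ ?_
  all_goals
    rintro ⟨i, j⟩ h
    simp only [Finset.mem_sigma, Finset.mem_range] at h
  · simp only [Finset.mem_sigma, Finset.mem_range]
    omega
  · simp only [Finset.mem_sigma, Finset.mem_range]
    omega
  · simp only [Sigma.mk.injEq, heq_eq_eq, and_true]
    omega
  · simp only [Sigma.mk.injEq, heq_eq_eq, true_and]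
    omega
  · rfl

namespace PlanePartition

variable {a b c : ℕ}

/-- The forced entries `b` contribute a constant independent of `T`, so the pattern weight is the
size up to a fixed shift. -/
theorem patternSum_toPattern (T : PlanePartition a b c) :
    patternSum (c + a) T.toPattern =
      T.size + ∑ i ∈ Finset.range a, ∑ _u ∈ Finset.range (c + a - 1 - (c + i)), b := by
  have h1 : patternSum (c + a) T.toPattern =
      ∑ d ∈ Finset.range (c + a), ∑ i ∈ Finset.range d, T.rectEntry i (d - 1 - i) := by
    refine Finset.sum_congr rfl fun d hd => Finset.sum_congr rfl fun i hi => ?_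
    rw [Finset.mem_range] at hd hi
    rw [toPattern, if_neg (by omega)]
  rw [h1, sum_range_triangle, Finset.sum_range_add]
  congr 1
  · have h2 : ∀ i ∈ Finset.range c, ∑ u ∈ Finset.range (c + a - 1 - i), T.rectEntry i u =
        ∑ u ∈ Finset.range a, T.heightNat u (c - 1 - i) := by
      intro i hi
      rw [Finset.mem_range] at hi
      symm
      have h3 : ∀ u, T.heightNat u (c - 1 - i) = T.rectEntry i u := fun _ => by
        rw [rectEntry, if_neg (by omega)]
      simp only [← h3]
      refine Finset.sum_subset (Finset.range_subset_range.mpr (by omega)) fun u _ hu => ?_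
      rw [Finset.mem_range] at hu
      rw [heightNat, dif_neg (by omega)]
    rw [Finset.sum_congr rfl h2,
      Finset.sum_range_reflect (fun k => ∑ u ∈ Finset.range a, T.heightNat u k) c,
      T.size_eq_sum_height, Finset.sum_comm, Finset.sum_range]
    refine Finset.sum_congr rfl fun u _ => ?_
    rw [Finset.sum_range]
    exact Finset.sum_congr rfl fun k _ => T.heightNat_apply u k
  · refine Finset.sum_congr rfl fun i _ => Finset.sum_congr rfl fun _ _ => ?_
    rw [rectEntry, if_pos (by omega)]

/-- The generating function of plane partitions in a box by number of cubes. -/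
noncomputable def genFun (a b c : ℕ) : ℚ[X] := ∑ T : PlanePartition a b c, X ^ T.size

theorem exists_sum_gtPatterns_eq (a b c : ℕ) :
    ∃ e, ∑ x ∈ gtPatterns (c + a) (rectRow b c), (X : ℚ[X]) ^ patternSum (c + a) x =
      X ^ e * genFun a b c := by
  refine ⟨∑ i ∈ Finset.range a, ∑ _u ∈ Finset.range (c + a - 1 - (c + i)), b, ?_⟩
  rw [genFun, Finset.mul_sum]
  symm
  refine Finset.sum_bij (fun T _ => T.toPattern) (fun T _ => T.toPattern_mem)
    (fun T _ T' _ h => toPattern_injective h)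
    (fun x hx => ?_) fun T _ => ?_
  · obtain ⟨T, hT⟩ := exists_toPattern_eq hx
    exact ⟨T, Finset.mem_univ T, hT⟩
  · rw [patternSum_toPattern, pow_add, mul_comm]

end PlanePartition

/-! ### MacMahon's formula. -/

theorem shiftedVandermonde_eq_prod {R : Type*} [CommRing R] (q : R) (n : ℕ) (l : ℕ → ℕ) :
    shiftedVandermonde q n l =
      ∏ j ∈ Finset.range n, ∏ i ∈ Finset.range j, (q ^ (l j + j) - q ^ (l i + i)) := by
  rw [shiftedVandermonde, Matrix.det_vandermonde,
    Finset.prod_comm' (t' := Finset.univ) (s' := fun j => Finset.Iio j) (by simp),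
    Finset.prod_range]
  refine Finset.prod_congr rfl fun j _ => ?_
  rw [← Nat.Iio_eq_range, ← Fin.map_valEmbedding_Iio, Finset.prod_map]
  rfl

theorem prod_pow_sub_pow_reflect (r n d : ℕ) :
    ∏ i ∈ Finset.range n, ((X : ℚ[X]) ^ (r + d + n) - X ^ (r + i)) =
      X ^ (∑ i ∈ Finset.range n, (r + i)) * ∏ i ∈ Finset.range n, (X ^ (d + i + 1) - 1) := by
  rw [← Finset.prod_pow_eq_pow_sum, ← Finset.prod_range_reflect (fun i => (X : ℚ[X]) ^ (d + i + 1) - 1),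
    ← Finset.prod_mul_distrib]
  refine Finset.prod_congr rfl fun i hi => ?_
  rw [Finset.mem_range] at hi
  rw [mul_sub, mul_one, ← pow_add]
  congr 2
  omega

/-- Pairs of indices lie both among the zeros of the row, both among the entries `b`, or in both
blocks. Up to powers of `X`, only the mixed pairs see `b`. -/
theorem exists_shiftedVandermonde_rectRow (a b c : ℕ) :
    ∃ e, shiftedVandermonde (X : ℚ[X]) (c + a) (rectRow b c) = X ^ e *
      ((∏ j ∈ Finset.range c, ∏ i ∈ Finset.range j, (X ^ (i + 1) - 1)) *
        (∏ j ∈ Finset.range a, ∏ i ∈ Finset.range j, (X ^ (i + 1) - 1)) *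
        ∏ j ∈ Finset.range a, ∏ i ∈ Finset.range c, (X ^ (b + j + i + 1) - 1)) := by
  refine ⟨(∑ j ∈ Finset.range c, ∑ i ∈ Finset.range j, i) + ∑ j ∈ Finset.range a,
    (∑ i ∈ Finset.range c, i + ∑ i ∈ Finset.range j, (b + c + i)), ?_⟩
  rw [shiftedVandermonde_eq_prod, Finset.prod_range_add, pow_add, ← Finset.prod_pow_eq_pow_sum,
    ← Finset.prod_pow_eq_pow_sum]
  have h1 : ∏ j ∈ Finset.range c, ∏ i ∈ Finset.range j,
      ((X : ℚ[X]) ^ (rectRow b c j + j) - X ^ (rectRow b c i + i)) =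
      (∏ j ∈ Finset.range c, X ^ (∑ i ∈ Finset.range j, i)) *
        ∏ j ∈ Finset.range c, ∏ i ∈ Finset.range j, (X ^ (i + 1) - 1) := by
    rw [← Finset.prod_mul_distrib]
    refine Finset.prod_congr rfl fun j hj => ?_
    rw [Finset.mem_range] at hj
    have h := prod_pow_sub_pow_reflect 0 j 0
    simp only [zero_add] at h
    rw [← h]
    refine Finset.prod_congr rfl fun i hi => ?_
    rw [Finset.mem_range] at hi
    rw [rectRow, rectRow, if_neg (by omega), if_neg (by omega), zero_add, zero_add]
  have h2 : ∏ j ∈ Finset.range a, ∏ i ∈ Finset.range (c + j),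
      ((X : ℚ[X]) ^ (rectRow b c (c + j) + (c + j)) - X ^ (rectRow b c i + i)) =
      (∏ j ∈ Finset.range a, X ^ (∑ i ∈ Finset.range c, i + ∑ i ∈ Finset.range j, (b + c + i))) *
        ((∏ j ∈ Finset.range a, ∏ i ∈ Finset.range j, (X ^ (i + 1) - 1)) *
          ∏ j ∈ Finset.range a, ∏ i ∈ Finset.range c, (X ^ (b + j + i + 1) - 1)) := by
    rw [← Finset.prod_mul_distrib, ← Finset.prod_mul_distrib]
    refine Finset.prod_congr rfl fun j hj => ?_
    have h := prod_pow_sub_pow_reflect 0 c (b + j)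
    have h' := prod_pow_sub_pow_reflect (b + c) j 0
    simp only [zero_add, add_zero] at h h'
    have e1 : ∏ i ∈ Finset.range c,
        ((X : ℚ[X]) ^ (rectRow b c (c + j) + (c + j)) - X ^ (rectRow b c i + i)) =
        ∏ i ∈ Finset.range c, (X ^ (b + j + c) - X ^ i) := by
      refine Finset.prod_congr rfl fun i hi => ?_
      rw [Finset.mem_range] at hi
      rw [rectRow, rectRow, if_pos (by omega), if_neg (by omega), zero_add,
        show b + (c + j) = b + j + c by ring]
    have e2 : ∏ i ∈ Finset.range j,
        ((X : ℚ[X]) ^ (rectRow b c (c + j) + (c + j)) - X ^ (rectRow b c (c + i) + (c + i))) =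
        ∏ i ∈ Finset.range j, (X ^ (b + c + j) - X ^ (b + c + i)) := by
      refine Finset.prod_congr rfl fun i hi => ?_
      rw [rectRow, rectRow, if_pos (by omega), if_pos (by omega), ← add_assoc, ← add_assoc]
    rw [Finset.prod_range_add, e1, e2, h, h', pow_add]
    ring
  rw [h1, h2]
  ring

/-- The same product with `b = 0`, so the two triangular factors will cancel and only the ratio of
the mixed rectangles survives. -/
theorem exists_gt_prefactor (a c : ℕ) :
    ∃ e, ∏ k ∈ Finset.range (c + a), ∏ j ∈ Finset.range k, (((X : ℚ[X]) ^ (j + 1) - 1) * X ^ j) =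
      X ^ e * ((∏ j ∈ Finset.range c, ∏ i ∈ Finset.range j, (X ^ (i + 1) - 1)) *
        (∏ j ∈ Finset.range a, ∏ i ∈ Finset.range j, (X ^ (i + 1) - 1)) *
        ∏ j ∈ Finset.range a, ∏ i ∈ Finset.range c, (X ^ (0 + j + i + 1) - 1)) := by
  refine ⟨∑ k ∈ Finset.range (c + a), ∑ j ∈ Finset.range k, j, ?_⟩
  have h : ∀ j, ∏ i ∈ Finset.range (c + j), ((X : ℚ[X]) ^ (i + 1) - 1) =
      (∏ i ∈ Finset.range j, (X ^ (i + 1) - 1)) *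
        ∏ i ∈ Finset.range c, (X ^ (0 + j + i + 1) - 1) := by
    intro j
    rw [add_comm, Finset.prod_range_add]
    simp only [zero_add]
  simp only [Finset.prod_mul_distrib, ← Finset.prod_pow_eq_pow_sum]
  rw [mul_comm, Finset.prod_range_add (fun x => ∏ i ∈ Finset.range x, ((X : ℚ[X]) ^ (i + 1) - 1))]
  simp only [h, Finset.prod_mul_distrib]
  ring

theorem X_pow_sub_one_eq (m : ℕ) : (X : ℚ[X]) ^ m - 1 = qInt m * (X - 1) :=
  (geom_sum_mul X m).symm

theorem qInt_eval_zero (m : ℕ) : (qInt (m + 1)).eval 0 = 1 := by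
  simp [qInt, eval_finsetSum, Finset.sum_range_succ']

theorem qInt_ne_zero (m : ℕ) : qInt (m + 1) ≠ 0 := by
  intro h
  simpa [h] using qInt_eval_zero m

/-- Nonzero constant terms fix the order of vanishing at `0`. This is why the powers of `X` above
need never be compared. -/
theorem eq_of_X_pow_mul_eq {e e' : ℕ} {p q : ℚ[X]} (hp : p.eval 0 ≠ 0) (hq : q.eval 0 ≠ 0)
    (h : X ^ e * p = X ^ e' * q) : p = q := by
  wlog hle : e ≤ e' generalizing e e' p q
  · exact (this hq hp h.symm (le_of_not_ge hle)).symm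
  obtain ⟨d, rfl⟩ := Nat.exists_eq_add_of_le hle
  rw [pow_add, mul_assoc] at h
  have h' := mul_left_cancel₀ (pow_ne_zero e X_ne_zero) h
  rcases Nat.eq_zero_or_pos d with rfl | hd
  · simpa using h'
  · refine absurd ?_ hp
    rw [h', eval_mul, eval_pow, eval_X, zero_pow hd.ne', zero_mul]

/-- The product of the `q`-integers `(m + i + j + 1)_q` over an `a × c` rectangle. -/
noncomputable def qRect (a c m : ℕ) : ℚ[X] :=
  ∏ j ∈ Finset.range a, ∏ i ∈ Finset.range c, qInt (m + j + i + 1)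

theorem prod_X_pow_sub_one (a c m : ℕ) :
    ∏ j ∈ Finset.range a, ∏ i ∈ Finset.range c, ((X : ℚ[X]) ^ (m + j + i + 1) - 1) =
      qRect a c m * (X - 1) ^ (c * a) := by
  simp only [qRect, X_pow_sub_one_eq, Finset.prod_mul_distrib, Finset.prod_const,
    Finset.card_range, pow_mul]

theorem qRect_eval_zero (a c m : ℕ) : (qRect a c m).eval 0 = 1 := by
  simp [qRect, eval_prod, qInt_eval_zero]

theorem PlanePartition.genFun_eval_zero_ne_zero (a b c : ℕ) : (genFun a b c).eval 0 ≠ 0 := by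
  have h : (genFun a b c).eval 0 = ∑ T : PlanePartition a b c, (0 : ℚ) ^ T.size := by
    simp [genFun, eval_finsetSum]
  rw [h]
  let T₀ : PlanePartition a b c := ⟨∅, by simpa using isLowerSet_empty⟩
  refine ((Finset.sum_pos' (fun T _ => by positivity) ⟨T₀, Finset.mem_univ _, ?_⟩)).ne'
  have : T₀.size = 0 := by simp [T₀, PlanePartition.size]
  simp [this]

/-- MacMahon's formula. -/
theorem PlanePartition.genFun_mul_qRect (a b c : ℕ) :
    genFun a b c * qRect a c 0 = qRect a c b := by
  obtain ⟨e₁, h₁⟩ := exists_shiftedVandermonde_rectRow a b c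
  obtain ⟨e₂, h₂⟩ := exists_gt_prefactor a c
  obtain ⟨e₃, h₃⟩ := exists_sum_gtPatterns_eq a b c
  have h := shiftedVandermonde_eq_sum (X : ℚ[X]) (c + a) (l := rectRow b c) fun i _ => by
    simp only [rectRow]
    split_ifs <;> omega
  rw [h₁, h₂, h₃, prod_X_pow_sub_one, prod_X_pow_sub_one] at h
  have hX : ∀ i : ℕ, (X : ℚ[X]) ^ (i + 1) - 1 ≠ 0 := fun i => by
    rw [X_pow_sub_one_eq]
    exact mul_ne_zero (qInt_ne_zero i) (X_sub_C_ne_zero 1)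
  have hK : ∀ n, ∏ j ∈ Finset.range n, ∏ i ∈ Finset.range j, ((X : ℚ[X]) ^ (i + 1) - 1) ≠ 0 :=
    fun n => Finset.prod_ne_zero_iff.mpr fun j _ => Finset.prod_ne_zero_iff.mpr fun i _ => hX i
  refine eq_of_X_pow_mul_eq (e := e₂ + e₃) (e' := e₁) ?_ ?_ ?_
  · rw [eval_mul, qRect_eval_zero, mul_one]
    exact genFun_eval_zero_ne_zero a b c
  · rw [qRect_eval_zero]
    exact one_ne_zero
  · refine mul_right_cancel₀ (mul_ne_zero (mul_ne_zero (hK c) (hK a))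
      (pow_ne_zero (c * a) (X_sub_C_ne_zero (1 : ℚ)))) ?_
    rw [map_one, pow_add]
    linear_combination -h

theorem qFact_add (m n : ℕ) :
    qFact (m + n) = qFact m * ∏ j ∈ Finset.range n, qInt (m + j + 1) :=
  Finset.prod_range_add _ _ _

theorem qHyper_add (m n : ℕ) :
    qHyper (m + n) = qHyper m * ∏ i ∈ Finset.range n, qFact (m + i) :=
  Finset.prod_range_add _ _ _

theorem qRect_mul_qHyper (a c m : ℕ) :
    qRect a c m * (qHyper (m + a) * qHyper (m + c)) = qHyper (m + c + a) * qHyper m := by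
  have h : (∏ i ∈ Finset.range a, qFact (m + i)) * qRect a c m =
      ∏ i ∈ Finset.range a, qFact (m + c + i) := by
    rw [qRect, ← Finset.prod_mul_distrib]
    refine Finset.prod_congr rfl fun i _ => ?_
    rw [add_right_comm, qFact_add (m + i) c]
  rw [qHyper_add m a, qHyper_add (m + c) a, ← h]
  ring

theorem PlanePartition.genFun_mul_qHyper (a b c : ℕ) :
    genFun a b c * (qHyper (a + b) * qHyper (a + c) * qHyper (b + c)) =
      qHyper (a + b + c) * qHyper a * qHyper b * qHyper c := by
  have h0 := qRect_mul_qHyper a c 0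
  have hb := qRect_mul_qHyper a c b
  have h := genFun_mul_qRect a b c
  have hz : qHyper 0 = 1 := rfl
  rw [zero_add, zero_add, hz, mul_one, add_comm c a] at h0
  rw [add_comm b a, show b + c + a = a + b + c by ring] at hb
  rw [← h0]
  linear_combination (qHyper a * qHyper c * qHyper (a + b) * qHyper (b + c)) * h +
    qHyper a * qHyper c * hb

theorem qHyper_ne_zero (n : ℕ) : qHyper n ≠ 0 :=
  Finset.prod_ne_zero_iff.mpr fun _ _ => Finset.prod_ne_zero_iff.mpr fun i _ => qInt_ne_zero i

theorem qMacMahon_eq_genFun (a b c : ℕ) :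
    qMacMahon a b c = algebraMap ℚ[X] (RatFunc ℚ) (PlanePartition.genFun a b c) := by
  rw [qMacMahon, div_eq_iff, ← map_mul, PlanePartition.genFun_mul_qHyper]
  rw [map_ne_zero_iff _ (RatFunc.algebraMap_injective ℚ)]
  exact mul_ne_zero (mul_ne_zero (qHyper_ne_zero _) (qHyper_ne_zero _)) (qHyper_ne_zero _)

/-! ### Evaluation at `q = 1` and `q = -1`, and Stanley's product. -/

open PlanePartition

theorem qInt_eval_one (n : ℕ) : (qInt n).eval 1 = n := by
  simp [qInt, eval_finsetSum]

theorem qFact_eval_one (n : ℕ) : (qFact n).eval 1 = n.factorial := by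
  rw [qFact, eval_prod, ← Finset.prod_range_add_one_eq_factorial, Nat.cast_prod]
  exact Finset.prod_congr rfl fun i _ => qInt_eval_one (i + 1)

theorem qHyper_eval_one (n : ℕ) : (qHyper n).eval 1 = hyperFact n := by
  rw [qHyper, eval_prod, hyperFact, Nat.cast_prod]
  exact Finset.prod_congr rfl fun i _ => qFact_eval_one i

theorem hyperFact_ne_zero (n : ℕ) : hyperFact n ≠ 0 :=
  Finset.prod_ne_zero_iff.mpr fun i _ => Nat.factorial_ne_zero i

theorem macMahon_eq_eval_genFun (a b c : ℕ) : macMahon a b c = (genFun a b c).eval 1 := by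
  have h := congrArg (eval 1) (genFun_mul_qHyper a b c)
  simp only [eval_mul, qHyper_eval_one] at h
  rw [macMahon, div_eq_iff, h]
  exact_mod_cast mul_ne_zero (mul_ne_zero (hyperFact_ne_zero _) (hyperFact_ne_zero _))
    (hyperFact_ne_zero _)

theorem macMahon_eq_prod (a b c : ℕ) :
    macMahon a b c = ∏ j ∈ Finset.range a, ∏ i ∈ Finset.range c,
      ((b + j + i + 1 : ℕ) : ℚ) / ((j + i + 1 : ℕ) : ℚ) := by
  have h := congrArg (eval 1) (genFun_mul_qRect a b c)
  simp only [eval_mul, qRect, eval_prod, qInt_eval_one, zero_add] at h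
  simp only [Finset.prod_div_distrib]
  rw [macMahon_eq_eval_genFun, eq_div_iff, h]
  exact Finset.prod_ne_zero_iff.mpr fun j _ => Finset.prod_ne_zero_iff.mpr fun i _ => by positivity

theorem macMahon_comm_left (a b c : ℕ) : macMahon a b c = macMahon b a c := by
  simp only [macMahon, add_comm b a]
  ring

theorem macMahon_comm_right (a b c : ℕ) : macMahon a b c = macMahon a c b := by
  simp only [macMahon, add_comm c b, add_right_comm a c b]
  ring

theorem qMacMahon_comm_left (a b c : ℕ) : qMacMahon a b c = qMacMahon b a c := by
  simp only [qMacMahon, add_comm b a]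
  congr 2 <;> ring

theorem qMacMahon_comm_right (a b c : ℕ) : qMacMahon a b c = qMacMahon a c b := by
  simp only [qMacMahon, add_comm c b, add_right_comm a c b]
  congr 2 <;> ring

theorem qMacMahon_eval (a b c : ℕ) (x : ℚ) :
    (qMacMahon a b c).eval (RingHom.id ℚ) x = (genFun a b c).eval x := by
  rw [qMacMahon_eq_genFun, RatFunc.eval_algebraMap]
  rfl

/-- The `q`-integer with its factor `1 + q` removed if there is one. -/
noncomputable def qIntReduced (m : ℕ) : ℚ[X] :=
  if Even m then ∑ i ∈ Finset.range (m / 2), X ^ (2 * i) else qInt m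

theorem qInt_eq_mul_qIntReduced (m : ℕ) :
    qInt m = (if Even m then 1 + X else 1) * qIntReduced m := by
  rw [qIntReduced]
  split_ifs with h
  · obtain ⟨k, rfl⟩ := h
    rw [← two_mul, Nat.mul_div_cancel_left k two_pos, qInt]
    induction k with
    | zero => simp
    | succ k ih =>
      rw [show 2 * (k + 1) = 2 * k + 1 + 1 by ring, Finset.sum_range_succ, Finset.sum_range_succ, ih,
        Finset.sum_range_succ]
      ring
  · rw [one_mul]

theorem qIntReduced_eval (m : ℕ) :
    (qIntReduced m).eval (-1) = if Even m then ((m / 2 : ℕ) : ℚ) else 1 := by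
  rw [qIntReduced]
  split_ifs with h
  · simp [eval_finsetSum, pow_mul]
  · obtain ⟨k, rfl⟩ := Nat.not_even_iff_odd.mp h
    have h0 : ∀ k, (qInt (2 * k)).eval (-1) = 0 := fun k => by
      rw [qInt_eq_mul_qIntReduced, if_pos (even_two_mul k)]
      simp
    have : qInt (2 * k + 1) = qInt (2 * k) + X ^ (2 * k) := Finset.sum_range_succ _ _
    rw [this, eval_add, h0, eval_pow, eval_X, pow_mul]
    simp

theorem prod_range_even_odd {M : Type*} [CommMonoid M] (f : ℕ → M) (n : ℕ) :
    ∏ j ∈ Finset.range n, f j = (∏ j ∈ Finset.range ((n + 1) / 2), f (2 * j)) *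
      ∏ j ∈ Finset.range (n / 2), f (2 * j + 1) := by
  induction n with
  | zero => simp
  | succ n ih =>
    rw [Finset.prod_range_succ, ih]
    rcases Nat.even_or_odd' n with ⟨k, rfl | rfl⟩
    · rw [show (2 * k + 1 + 1) / 2 = k + 1 by omega, show (2 * k + 1) / 2 = k by omega,
        show 2 * k / 2 = k by omega, Finset.prod_range_succ (fun j => f (2 * j))]
      exact mul_right_comm _ _ _
    · rw [show (2 * k + 1 + 1 + 1) / 2 = k + 1 by omega, show (2 * k + 1 + 1) / 2 = k + 1 by omega,
        show (2 * k + 1) / 2 = k by omega, Finset.prod_range_succ (fun j => f (2 * j + 1)), mul_assoc]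

/-- Because the second side is even, the `q`-integers at each position `(j, i)` in MacMahon's
numerator and denominator have equal parity, so their factors `1 + q` cancel. At `q = -1` only
positions with `j` and `i` of opposite parity contribute; they form two rectangular sublattices,
each giving an ordinary MacMahon product. -/
theorem genFun_eval_neg_one_of_even (a t c : ℕ) :
    (genFun a (2 * t) c).eval (-1) =
      macMahon ((a + 1) / 2) t (c / 2) * macMahon (a / 2) t ((c + 1) / 2) := by
  have h1X : (1 + X : ℚ[X]) ≠ 0 := fun h => by
    have := congrArg (eval 0) h
    simp at this
  have hpar : ∀ m : ℕ, (if Even m then 1 + X else 1 : ℚ[X]) ≠ 0 := fun m => by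
    split_ifs
    · exact h1X
    · exact one_ne_zero
  have h := genFun_mul_qRect a (2 * t) c
  simp only [qRect] at h
  simp only [qInt_eq_mul_qIntReduced, Finset.prod_mul_distrib] at h
  have hshift : ∀ j i, Even (2 * t + j + i + 1) ↔ Even (0 + j + i + 1) := fun j i => by
    simp only [Nat.even_iff]
    omega
  simp only [hshift] at h
  rw [mul_left_comm] at h
  have h' := congrArg (eval (-1)) (mul_left_cancel₀ (Finset.prod_ne_zero_iff.mpr fun j _ =>
    Finset.prod_ne_zero_iff.mpr fun i _ => hpar _) h)
  simp only [eval_mul, eval_prod, qIntReduced_eval, hshift] at h'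
  simp only [zero_add] at h'
  have hden : ∏ j ∈ Finset.range a, ∏ i ∈ Finset.range c,
      (if Even (j + i + 1) then (((j + i + 1) / 2 : ℕ) : ℚ) else 1) ≠ 0 := by
    refine Finset.prod_ne_zero_iff.mpr fun j _ => Finset.prod_ne_zero_iff.mpr fun i _ => ?_
    split_ifs with he
    · rw [Nat.even_iff] at he
      exact Nat.cast_ne_zero.mpr (by omega)
    · exact one_ne_zero
  rw [eq_div_of_mul_eq hden h']
  simp only [← Finset.prod_div_distrib]
  rw [prod_range_even_odd, macMahon_eq_prod, macMahon_eq_prod]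
  congr 1
  all_goals
    refine Finset.prod_congr rfl fun j _ => ?_
    rw [prod_range_even_odd]
  · rw [Finset.prod_eq_one, one_mul]
    · refine Finset.prod_congr rfl fun i _ => ?_
      rw [if_pos (by rw [Nat.even_iff]; omega), if_pos (by rw [Nat.even_iff]; omega)]
      congr 2 <;> omega
    · intro i _
      rw [if_neg (by rw [Nat.even_iff]; omega), if_neg (by rw [Nat.even_iff]; omega), div_one]
  -- For odd `j` it is the odd `i` that contribute trivially, hence the swap.
  · rw [mul_comm, Finset.prod_eq_one, one_mul]
    · refine Finset.prod_congr rfl fun i _ => ?_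
      rw [if_pos (by rw [Nat.even_iff]; omega), if_pos (by rw [Nat.even_iff]; omega)]
      congr 2 <;> omega
    · intro i _
      rw [if_neg (by rw [Nat.even_iff]; omega), if_neg (by rw [Nat.even_iff]; omega), div_one]

/-- A self-complementary plane partition fills exactly half of the box, whose volume is odd. -/
theorem numSelfCompl_eq_zero {a b c : ℕ} (ha : Odd a) (hb : Odd b) (hc : Odd c) :
    numSelfCompl a b c = 0 := by
  rw [numSelfCompl, Nat.card_eq_zero]
  left
  refine ⟨fun ⟨T, hT⟩ => ?_⟩
  have h1 : T.compl.size = (a * (b * c)) - T.size := by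
    rw [PlanePartition.size, PlanePartition.compl, Finset.card_image_of_injective, Finset.card_compl]
    · simp [PlanePartition.size]
    · exact Function.Involutive.injective (boxRev_boxRev a b c)
  have h2 : T.size ≤ a * (b * c) := by
    simpa [PlanePartition.size] using Finset.card_le_univ T.1
  have h3 := ha.mul (hb.mul hc)
  rw [hT] at h1
  rw [Nat.odd_iff] at h3
  omega

theorem numSelfCompl_eq_eval_genFun (a b c : ℕ) :
    (numSelfCompl a b c : ℚ) = (genFun a b c).eval (-1) := by
  rw [numSelfCompl_eq_sum]
  simp [genFun, eval_finsetSum]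

theorem sum_neg_one_pow_size (a b c : ℕ) :
    ∑ T : PlanePartition a b c, (-1 : ℤ) ^ T.size =
      (Nat.card {T : PlanePartition a b c // Even T.size} : ℤ) -
        (Nat.card {T : PlanePartition a b c // Odd T.size} : ℤ) := by
  classical
  simp only [Nat.card_eq_fintype_card, Fintype.card_subtype, Finset.card_filter, Nat.cast_sum]
  rw [← Finset.sum_sub_distrib]
  refine Finset.sum_congr rfl fun T _ => ?_
  rcases Nat.even_or_odd T.size with h | h
  · rw [h.neg_one_pow, if_pos h, if_neg (Nat.not_odd_iff_even.mpr h)]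
    simp
  · rw [h.neg_one_pow, if_neg (Nat.not_even_iff_odd.mpr h), if_pos h]
    simp

theorem mainTheorem2 (a b c : ℕ) :
    -- the rational function `N(a,b,c)_q` has no pole at `q = -1`
    (qMacMahon a b c).denom.eval (-1) ≠ 0 ∧
    -- `N_κ(a,b,c) = N(a,b,c)_{-1}`
    (numSelfCompl a b c : ℚ) = (qMacMahon a b c).eval (RingHom.id ℚ) (-1) ∧
    -- the `q = -1` phenomenon
    (numSelfCompl a b c : ℤ) =
      (Nat.card {T : PlanePartition a b c // Even T.size} : ℤ) -
        (Nat.card {T : PlanePartition a b c // Odd T.size} : ℤ) ∧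
    -- `N(a,b,c)_{-1}` is Stanley's product
    (qMacMahon a b c).eval (RingHom.id ℚ) (-1) = stanleyProduct a b c := by
  refine ⟨?_, ?_, ?_, ?_⟩
  · rw [qMacMahon_eq_genFun, RatFunc.denom_algebraMap, eval_one]
    exact one_ne_zero
  · rw [qMacMahon_eval, numSelfCompl_eq_eval_genFun]
  · rw [← sum_neg_one_pow_size]
    exact_mod_cast numSelfCompl_eq_sum a b c
  · rw [stanleyProduct]
    split_ifs with hc hb ha
    -- The evaluation at `-1` requires the even side in the middle position; the symmetry of
    -- MacMahon's product moves it there.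
    · obtain ⟨t, rfl⟩ := hc.two_dvd
      rw [qMacMahon_comm_right, qMacMahon_eval, genFun_eval_neg_one_of_even,
        Nat.mul_div_cancel_left t two_pos, macMahon_comm_right _ t, macMahon_comm_right _ t]
    · obtain ⟨t, rfl⟩ := hb.two_dvd
      rw [qMacMahon_eval, genFun_eval_neg_one_of_even, Nat.mul_div_cancel_left t two_pos]
    · obtain ⟨t, rfl⟩ := ha.two_dvd
      rw [qMacMahon_comm_left, qMacMahon_eval, genFun_eval_neg_one_of_even,
        Nat.mul_div_cancel_left t two_pos, macMahon_comm_left _ t, macMahon_comm_left _ t]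
    -- With all sides odd, the value at `-1` is found from the count `N_κ` rather than from the
    -- product.
    · rw [qMacMahon_eval, ← numSelfCompl_eq_eval_genFun, numSelfCompl_eq_zero
        (Nat.not_even_iff_odd.mp ha) (Nat.not_even_iff_odd.mp hb) (Nat.not_even_iff_odd.mp hc)]
      exact Nat.cast_zero
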